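/- Let $\mathbb F$ be an algebraically closed field of characteristic zero. Let $\mathcal C$ be a BTC over $\mathbb F$: a semisimple $\mathbb F$-linear rigid braided ribbon category (braiding $c$, twist $\Theta$) with finite-dimensional Hom-spaces and $\mathrm{End}\,\mathbf 1=\mathbb F\,\mathrm{id}_{\mathbf 1}$. For $X\in\mathcal C$ with dual $\overline X$ let $\varepsilon_X:\mathbf 1\to X\otimes\overline X$ and $e_X:\overline X\otimes X\to\mathbf 1$ be the duality morphisms, let $\overline\varepsilon_X=e_X\circ c_{X,\overline X}\circ(\Theta(X)\otimes\mathrm{id}_{\overline X}):X\otimes\overline X\to\mathbf 1$, and put $d(X)=\overline\varepsilon_X\circ\varepsilon_X\in\mathbb F$. Let $\mathcal S\subset\mathcal C$ be a full tensor subcategory, closed up to isomorphism under duals, direct sums and direct summands, with finitely many isomorphism classes of simple objects, on which the braiding is symmetric, and which is admissible: either $\mathbb F=\mathbb C$, $\mathcal S$ has a positive $*$-operation and $\Theta(X)=\mathrm{id}_X$ for all $X\in\mathcal S$, or $d(X)\in\mathbb Z_{\ge 0}$ for all $X\in\mathcal S$. Let $G_0$ be a finite group with an $\mathbb F$-linear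 braided tensor equivalence $\mathrm{Rep}_{\mathbb F}G_0\simeq\mathcal S$, and let $(\Gamma,m,\eta,\Delta,\varepsilon)$ be the image in $\mathcal C$ of the Frobenius algebra of functions $G_0\to\mathbb F$ carrying the left regular representation, with pointwise multiplication $m$, unit the constant function $1$, $\Delta(\delta_g)=|G_0|\,\delta_g\otimes\delta_g$ and $\varepsilon(f)=|G_0|^{-1}\sum_g f(g)$. Let $\mathcal C\rtimes_0\mathcal S$ be the category with the objects of $\mathcal C$, morphisms $\mathrm{Hom}(X,Y)=\mathrm{Hom}_{\mathcal C}(\Gamma\otimes X,Y)$, identities $\varepsilon\otimes\mathrm{id}_X$ and composition $t\,\tilde\circ\,s=t\circ(\mathrm{id}_\Gamma\otimes s)\circ(\Delta\otimes\mathrm{id}_X)$, and let $\mathcal C\rtimes\mathcal S$ be its idempotent completion, whose objects are the pairs $(X,p)$ with $p=p^2\in\mathrm{End}_{\mathcal C\rtimes_0\mathcal S}(X)$. Let $(X,p)\in\mathcal C\rtimes\mathcal S$ be simple. Then $d(X,p):=\overline\varepsilon_X\circ(p\otimes\mathrm{id}_{\overline X})\circ(\eta\otimes\varepsilon_X)\in\mathbb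 F$ is non-zero, and the endomorphism of $\Gamma$ $$\partial(X,p)=d(X,p)^{-1}\,(\mathrm{id}_\Gamma\otimes\overline\varepsilon_X)\circ\big((c_{\Gamma,X}^{-1}\circ c_{X,\Gamma}^{-1})\otimes\mathrm{id}_{\overline X}\big)\circ(\mathrm{id}_\Gamma\otimes p\otimes\mathrm{id}_{\overline X})\circ(\Delta\otimes\varepsilon_X)$$ is an automorphism of the monoid $(\Gamma,m,\eta)$, that is, an element of the group $G=\mathrm{Aut}(\Gamma,m,\eta)$. -/

import Mathlib

open CategoryTheory MonoidalCategory Limits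
open scoped TensorProduct

universe v u w

noncomputable section

/-! ### Ribbon categories and BTCs -/

namespace BTC

/-- A ribbon structure (twist) on a braided category with duals. -/
class RibbonCategory (C : Type u) [Category.{v} C] [MonoidalCategory C] [BraidedCategory C]
    [RigidCategory C] where
  /-- the twist `Θ(X)` -/
  twist (X : C) : X ≅ X
  twist_naturality {X Y : C} (f : X ⟶ Y) : f ≫ (twist Y).hom = (twist X).hom ≫ f
  twist_tensor (X Y : C) :
    (twist (X ⊗ Y)).hom =
      (β_ X Y).hom ≫ (β_ Y X).hom ≫ ((twist X).hom ⊗ₘ (twist Y).hom)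
  twist_dual (X : C) : (twist Xᘁ).hom = (twist X).homᘁ

/-- A semisimple `𝔽`-linear rigid braided ribbon category with finite-dimensional hom-spaces and
`End 𝟙 = 𝔽`. -/
class IsBTC (𝔽 : Type w) [Field 𝔽] (C : Type u) [Category.{v} C] [Abelian C] [Linear 𝔽 C]
    [MonoidalCategory C] [MonoidalPreadditive C] [MonoidalLinear 𝔽 C] [BraidedCategory C]
    [RigidCategory C] [RibbonCategory C] : Prop where
  semisimple (X : C) : ∃ (n : ℕ) (f : Fin n → C) (b : Bicone f),
    (∀ i, Simple (f i)) ∧ Nonempty b.IsBilimit ∧ Nonempty (X ≅ b.pt)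
  finite_hom (X Y : C) : Module.Finite 𝔽 (X ⟶ Y)
  end_unit : Function.Bijective (fun a : 𝔽 => a • 𝟙 (𝟙_ C))

section Trace

variable {C : Type u} [Category.{v} C] [MonoidalCategory C] [BraidedCategory C]
  [RigidCategory C] [RibbonCategory C]

/-- The evaluation `X ⊗ Xᘁ ⟶ 𝟙` of the spherical structure determined by the twist. -/
def evBar (X : C) : X ⊗ Xᘁ ⟶ 𝟙_ C :=
  (RibbonCategory.twist X).hom ▷ Xᘁ ≫ (β_ X Xᘁ).hom ≫ ε_ X Xᘁ

/-- The trace of an endomorphism, as an endomorphism of the unit. -/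
def trace {X : C} (f : X ⟶ X) : 𝟙_ C ⟶ 𝟙_ C :=
  η_ X Xᘁ ≫ f ▷ Xᘁ ≫ evBar X

/-- The partial trace over the second tensor factor. -/
def partialTrace {A B X : C} (f : A ⊗ X ⟶ B ⊗ X) : A ⟶ B :=
  (ρ_ A).inv ≫ A ◁ η_ X Xᘁ ≫ (α_ A X Xᘁ).inv ≫ f ▷ Xᘁ ≫ (α_ B X Xᘁ).hom ≫
    B ◁ evBar X ≫ (ρ_ B).hom

end Trace

section Linear

variable (𝔽 : Type w) [Field 𝔽] {C : Type u} [Category.{v} C] [Abelian C] [Linear 𝔽 C]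
  [MonoidalCategory C] [MonoidalPreadditive C] [MonoidalLinear 𝔽 C] [BraidedCategory C]
  [RigidCategory C] [RibbonCategory C] [IsBTC 𝔽 C]

/-- The scalar `a` with `f = a • 𝟙`, for `f` an endomorphism of the unit. -/
def unitScalar (f : 𝟙_ C ⟶ 𝟙_ C) : 𝔽 :=
  (Equiv.ofBijective _ (IsBTC.end_unit (𝔽 := 𝔽) (C := C))).symm f

/-- The dimension `d(X)`. -/
def dim (X : C) : 𝔽 := unitScalar 𝔽 (trace (𝟙 X))

end Linear

/-! ### Full sub-STCs, finiteness, admissibility -/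

/-- A positive `*`-operation on a linear tensor category over a field identified with `ℂ`. -/
structure StarStructure (𝔽 : Type w) [Field 𝔽] (σ : 𝔽 ≃+* ℂ) (D : Type u) [Category.{v} D]
    [Preadditive D] [Linear 𝔽 D] [MonoidalCategory D] where
  star {X Y : D} (f : X ⟶ Y) : Y ⟶ X
  star_star {X Y : D} (f : X ⟶ Y) : star (star f) = f
  star_comp {X Y Z : D} (f : X ⟶ Y) (g : Y ⟶ Z) : star (f ≫ g) = star g ≫ star f
  star_add {X Y : D} (f g : X ⟶ Y) : star (f + g) = star f + star g
  star_smul {X Y : D} (a : 𝔽) (f : X ⟶ Y) :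
    star (a • f) = σ.symm (starRingEnd ℂ (σ a)) • star f
  star_tensor {X Y Z T : D} (f : X ⟶ Y) (g : Z ⟶ T) : star (f ⊗ₘ g) = star f ⊗ₘ star g
  star_associator (X Y Z : D) : star (α_ X Y Z).hom = (α_ X Y Z).inv
  star_leftUnitor (X : D) : star (λ_ X).hom = (λ_ X).inv
  star_rightUnitor (X : D) : star (ρ_ X).hom = (ρ_ X).inv
  positive {X Y : D} (f : X ⟶ Y) : f ≫ star f = 0 → f = 0

section Sub

variable (𝔽 : Type w) [Field 𝔽] {C : Type u} [Category.{v} C] [Abelian C] [Linear 𝔽 C]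
  [MonoidalCategory C] [MonoidalPreadditive C] [MonoidalLinear 𝔽 C] [BraidedCategory C]
  [RigidCategory C]

/-- The full subcategory on the objects satisfying `S` is a finite sub-STC: it contains the unit
and is closed under `⊗` (this is `S.IsMonoidal`), the braiding restricts to a symmetry, it is
closed up to isomorphism under duals, direct sums and direct summands, and it has finitely many
isomorphism classes of simple objects. -/
class IsFiniteSubSTC (S : ObjectProperty C) : Prop extends S.IsMonoidal where
  symmetric (X Y : C) (hX : S X) (hY : S Y) : (β_ X Y).hom ≫ (β_ Y X).hom = 𝟙 (X ⊗ Y)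
  dual (X : C) (hX : S X) : S.isoClosure Xᘁ
  biprod (X Y : C) (hX : S X) (hY : S Y) : S.isoClosure (X ⊞ Y)
  retract (X Y : C) (hX : S X) (r : Retract Y X) : S.isoClosure Y
  finite : ∃ (n : ℕ) (f : Fin n → C), ∀ X, S X → Simple X → ∃ i, Nonempty (X ≅ f i)

/-- Admissibility of a sub-STC: either (i) the ground field is `ℂ`, the subcategory is a
`*`-category and all its objects have trivial twist, or (ii) the ground field has characteristic
zero and all dimensions of objects are non-negative integers. -/
def IsAdmissible [RibbonCategory C] [IsBTC 𝔽 C] (S : ObjectProperty C) [S.IsMonoidal] : Prop :=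
  (∃ σ : 𝔽 ≃+* ℂ, Nonempty (StarStructure 𝔽 σ S.FullSubcategory) ∧
      ∀ X, S X → (RibbonCategory.twist X).hom = 𝟙 X) ∨
    (CharZero 𝔽 ∧ ∀ X, S X → ∃ n : ℕ, dim 𝔽 X = n)

end Sub

end BTC

/-! ### The Frobenius algebra of functions on a finite group

The left regular representation of `G` on `𝔽`-valued functions on `G`, with pointwise
multiplication, `η(1) = 1`, `Δ(δ_g) = |G| δ_g ⊗ δ_g` and `ε(f) = |G|⁻¹ ∑ f(g)`. -/

namespace RegularAlgebra

section LinearMaps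

variable (𝔽 : Type w) [Field 𝔽] (G : Type)

/-- The constant functions. -/
def unitL : 𝔽 →ₗ[𝔽] (G → 𝔽) := LinearMap.toSpanSingleton 𝔽 (G → 𝔽) 1

/-- Pointwise multiplication. -/
def mulL : (G → 𝔽) ⊗[𝔽] (G → 𝔽) →ₗ[𝔽] (G → 𝔽) := LinearMap.mul' 𝔽 (G → 𝔽)

/-- The normalized sum of values. -/
def counitL [Fintype G] : (G → 𝔽) →ₗ[𝔽] 𝔽 :=
  (Fintype.card G : 𝔽)⁻¹ • ∑ g : G, LinearMap.proj g

open Classical in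
/-- `f ↦ |G| ∑_g f(g) δ_g ⊗ δ_g`. -/
def comulL [Fintype G] : (G → 𝔽) →ₗ[𝔽] (G → 𝔽) ⊗[𝔽] (G → 𝔽) :=
  (Fintype.card G : 𝔽) • ∑ g : G, (LinearMap.toSpanSingleton 𝔽 _
    (Pi.single g 1 ⊗ₜ[𝔽] Pi.single g 1)) ∘ₗ LinearMap.proj g

open Classical in
theorem comulL_single [Fintype G] (g : G) :
    comulL 𝔽 G (Pi.single g 1) =
      (Fintype.card G : 𝔽) • (Pi.single g 1 ⊗ₜ[𝔽] Pi.single g 1) := by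
  simp [comulL, Pi.single_apply, ite_smul]

open Classical in
theorem counitL_single [Fintype G] (g : G) :
    counitL 𝔽 G (Pi.single g 1) = (Fintype.card G : 𝔽)⁻¹ := by
  simp [counitL, Pi.single_apply]

end LinearMaps

theorem FDRep_hom_ext {𝔽 : Type w} [Field 𝔽] {G : Type} [Group G] {V W : FDRep 𝔽 G} {f g : V ⟶ W}
    (h : f.hom.hom.hom = g.hom.hom.hom) : f = g := by
  apply Action.Hom.ext
  apply InducedCategory.hom_ext
  exact ModuleCat.hom_ext h

/-- The left regular representation `(g • f)(h) = f(g⁻¹ h)`. -/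
def regRho (𝔽 : Type w) [Field 𝔽] (G : Type) [Group G] : Representation 𝔽 G (G → 𝔽) where
  toFun g := LinearMap.funLeft 𝔽 𝔽 (fun h => g⁻¹ * h)
  map_one' := by ext; simp [LinearMap.funLeft]
  map_mul' a b := by ext; simp [LinearMap.funLeft, _root_.mul_assoc]

variable (𝔽 : Type w) [Field 𝔽] (G : Type) [Group G] [Fintype G]

/-- The left regular representation as an object of `Rep G`. -/
def regRep : FDRep 𝔽 G := FDRep.of (regRho 𝔽 G)

/-- The unit `η`. -/
def regOne : 𝟙_ (FDRep 𝔽 G) ⟶ regRep 𝔽 G where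
  hom := FGModuleCat.ofHom (unitL 𝔽 G)
  comm g := by
    apply InducedCategory.hom_ext; apply ModuleCat.hom_ext
    change unitL 𝔽 G ∘ₗ LinearMap.id = regRho 𝔽 G g ∘ₗ unitL 𝔽 G
    ext
    simp [unitL, regRho, LinearMap.funLeft]

/-- The multiplication `m`. -/
def regMul : regRep 𝔽 G ⊗ regRep 𝔽 G ⟶ regRep 𝔽 G where
  hom := FGModuleCat.ofHom (mulL 𝔽 G)
  comm g := by
    apply InducedCategory.hom_ext; apply ModuleCat.hom_ext
    change mulL 𝔽 G ∘ₗ TensorProduct.map (regRho 𝔽 G g) (regRho 𝔽 G g) =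
      regRho 𝔽 G g ∘ₗ mulL 𝔽 G
    apply TensorProduct.ext'
    intro x y
    ext h
    simp [mulL, regRho, LinearMap.funLeft]

/-- The counit `ε`. -/
def regCounit : regRep 𝔽 G ⟶ 𝟙_ (FDRep 𝔽 G) where
  hom := FGModuleCat.ofHom (counitL 𝔽 G)
  comm g := by
    apply InducedCategory.hom_ext; apply ModuleCat.hom_ext
    change counitL 𝔽 G ∘ₗ regRho 𝔽 G g = LinearMap.id ∘ₗ counitL 𝔽 G
    refine LinearMap.ext fun x => ?_
    simp only [counitL, regRho, LinearMap.funLeft, LinearMap.comp_apply, LinearMap.smul_apply,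
      LinearMap.sum_apply, LinearMap.proj_apply, LinearMap.id_apply]
    congr 1
    exact Equiv.sum_comp (Equiv.mulLeft g⁻¹) x

/-- The comultiplication `Δ`. -/
def regComul : regRep 𝔽 G ⟶ regRep 𝔽 G ⊗ regRep 𝔽 G where
  hom := FGModuleCat.ofHom (comulL 𝔽 G)
  comm g := by
    classical
    apply InducedCategory.hom_ext; apply ModuleCat.hom_ext
    change comulL 𝔽 G ∘ₗ regRho 𝔽 G g =
      TensorProduct.map (regRho 𝔽 G g) (regRho 𝔽 G g) ∘ₗ comulL 𝔽 G
    refine LinearMap.ext fun x => ?_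
    have key : ∀ h : G, regRho 𝔽 G g (Pi.single h 1) = Pi.single (g * h) 1 := by
      intro h; ext k
      simp [regRho, LinearMap.funLeft, Pi.single_apply, inv_mul_eq_iff_eq_mul]
    simp only [comulL, LinearMap.comp_apply, LinearMap.smul_apply, LinearMap.sum_apply,
      LinearMap.proj_apply, map_smul, map_sum, LinearMap.toSpanSingleton_apply,
      TensorProduct.map_tmul, key]
    congr 1
    rw [← Equiv.sum_comp (Equiv.mulLeft g)]
    simp [regRho, LinearMap.funLeft]

instance : MonObj (regRep 𝔽 G) where
  one := regOne 𝔽 G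
  mul := regMul 𝔽 G
  one_mul := by
    apply FDRep_hom_ext
    rw [Action.leftUnitor_hom_hom]
    change mulL 𝔽 G ∘ₗ TensorProduct.map (unitL 𝔽 G) LinearMap.id =
      (TensorProduct.lid 𝔽 (G → 𝔽)).toLinearMap
    apply TensorProduct.ext'
    intro x y
    ext h
    simp [mulL, unitL]
  mul_one := by
    apply FDRep_hom_ext
    rw [Action.rightUnitor_hom_hom]
    change mulL 𝔽 G ∘ₗ TensorProduct.map LinearMap.id (unitL 𝔽 G) =
      (TensorProduct.rid 𝔽 (G → 𝔽)).toLinearMap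
    apply TensorProduct.ext'
    intro x y
    ext h
    simp [mulL, unitL]
  mul_assoc := by
    apply FDRep_hom_ext
    rw [Action.comp_hom, Action.comp_hom, Action.comp_hom, Action.associator_hom_hom]
    change mulL 𝔽 G ∘ₗ TensorProduct.map (mulL 𝔽 G) LinearMap.id =
      mulL 𝔽 G ∘ₗ TensorProduct.map LinearMap.id (mulL 𝔽 G) ∘ₗ
        (TensorProduct.assoc 𝔽 _ _ _).toLinearMap
    apply TensorProduct.ext_threefold
    intro x y z
    ext h
    simp [mulL, _root_.mul_assoc]

instance [CharZero 𝔽] : ComonObj (regRep 𝔽 G) where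
  counit := regCounit 𝔽 G
  comul := regComul 𝔽 G
  counit_comul := by
    classical
    have hc : (Fintype.card G : 𝔽) ≠ 0 := Nat.cast_ne_zero.mpr Fintype.card_ne_zero
    apply FDRep_hom_ext
    change TensorProduct.map (counitL 𝔽 G) LinearMap.id ∘ₗ comulL 𝔽 G =
      (TensorProduct.lid 𝔽 (G → 𝔽)).symm.toLinearMap
    refine LinearMap.pi_ext' fun g => LinearMap.ext_ring ?_
    simp only [LinearMap.comp_apply, LinearMap.single_apply, comulL_single, map_smul,
      TensorProduct.map_tmul, counitL_single, TensorProduct.smul_tmul', LinearMap.id_apply,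
      smul_eq_mul, mul_inv_cancel₀ hc]
    rfl
  comul_counit := by
    classical
    have hc : (Fintype.card G : 𝔽) ≠ 0 := Nat.cast_ne_zero.mpr Fintype.card_ne_zero
    apply FDRep_hom_ext
    change TensorProduct.map LinearMap.id (counitL 𝔽 G) ∘ₗ comulL 𝔽 G =
      (TensorProduct.rid 𝔽 (G → 𝔽)).symm.toLinearMap
    refine LinearMap.pi_ext' fun g => LinearMap.ext_ring ?_
    simp only [LinearMap.comp_apply, LinearMap.single_apply, comulL_single, map_smul,
      TensorProduct.map_tmul, counitL_single, LinearMap.id_apply, ← TensorProduct.tmul_smul,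
      smul_eq_mul, mul_inv_cancel₀ hc]
    rfl
  comul_assoc := by
    classical
    apply FDRep_hom_ext
    rw [Action.comp_hom, Action.comp_hom, Action.comp_hom, Action.associator_hom_hom]
    change TensorProduct.map LinearMap.id (comulL 𝔽 G) ∘ₗ comulL 𝔽 G =
      (TensorProduct.assoc 𝔽 _ _ _).toLinearMap ∘ₗ
        TensorProduct.map (comulL 𝔽 G) LinearMap.id ∘ₗ comulL 𝔽 G
    refine LinearMap.pi_ext' fun g => LinearMap.ext_ring ?_
    simp [comulL_single, ← TensorProduct.smul_tmul', TensorProduct.tmul_smul]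

end RegularAlgebra

/-! ### The crossed product -/

namespace CrossedProduct

section Algebra

variable {𝔽 : Type w} [Field 𝔽] {G : Type} [Group G] [Fintype G]
  {C : Type u} [Category.{v} C] [MonoidalCategory C] (F : FDRep 𝔽 G ⥤ C) [F.Monoidal]

/-- The image `Γ` in `C` of the regular Frobenius algebra of `G` under a tensor functor
`Rep G ⥤ C`. -/
def galoisAlgebra : C := F.obj (RegularAlgebra.regRep 𝔽 G)

instance : MonObj (galoisAlgebra F) :=
  Functor.monObjObj (F := F) (RegularAlgebra.regRep 𝔽 G)

instance [CharZero 𝔽] : ComonObj (galoisAlgebra F) :=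
  Functor.obj.instComonObj (RegularAlgebra.regRep 𝔽 G) F

end Algebra

section Category

variable {C : Type u} [Category.{v} C] [MonoidalCategory C]

/-- The objects of `C ⋊₀ S`, that is, the objects of `C`. -/
structure Pre (Γ : C) where
  obj : C

variable (Γ : C) [ComonObj Γ]

/-- `Hom(X, Y)` in `C ⋊₀ S` is `Hom_C(Γ ⊗ X, Y)`, and `t ∘ s = t (id_Γ ⊗ s) (Δ ⊗ id_X)`. -/
instance : Category (Pre Γ) where
  Hom X Y := Γ ⊗ X.obj ⟶ Y.obj
  id X := ComonObj.counit ▷ X.obj ≫ (λ_ X.obj).hom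
  comp {X _ _} s t := ComonObj.comul ▷ X.obj ≫ (α_ Γ Γ X.obj).hom ≫ Γ ◁ s ≫ t
  id_comp {X Y} f := by
    change Γ ⊗ X.obj ⟶ Y.obj at f
    have h : ComonObj.comul ▷ X.obj ≫ (α_ Γ Γ X.obj).hom ≫
        Γ ◁ (ComonObj.counit ▷ X.obj ≫ (λ_ X.obj).hom) = 𝟙 (Γ ⊗ X.obj) := by
      have := congrArg (· ▷ X.obj) (ComonObj.comul_counit Γ)
      simp only [comp_whiskerRight] at this
      simp only [MonoidalCategory.whiskerLeft_comp, ← associator_naturality_middle_assoc,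
        reassoc_of% this]
      simp
    rw [← Category.assoc (ComonObj.comul ▷ X.obj), ← Category.assoc, Category.assoc _ _ (Γ ◁ _)]
    rw [h, Category.id_comp]
  comp_id {X Y} f := by
    change Γ ⊗ X.obj ⟶ Y.obj at f
    have := congrArg (· ▷ X.obj) (ComonObj.counit_comul Γ)
    simp only [comp_whiskerRight] at this
    rw [whisker_exchange_assoc, leftUnitor_naturality, ← associator_naturality_left_assoc,
      reassoc_of% this]
    simp
  assoc {X Y Z T} f g h := by
    change Γ ⊗ X.obj ⟶ Y.obj at f
    change Γ ⊗ Y.obj ⟶ Z.obj at g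
    change Γ ⊗ Z.obj ⟶ T.obj at h
    have := congrArg (· ▷ X.obj) (ComonObj.comul_assoc Γ)
    simp only [comp_whiskerRight] at this
    simp only [MonoidalCategory.whiskerLeft_comp, Category.assoc,
      ← associator_naturality_middle_assoc, reassoc_of% this, whisker_exchange_assoc,
      ← associator_naturality_left_assoc]
    simp

instance [Preadditive C] [MonoidalPreadditive C] : Preadditive (Pre Γ) where
  homGroup X Y := inferInstanceAs (AddCommGroup (Γ ⊗ X.obj ⟶ Y.obj))
  add_comp X Y Z f g h := by
    change Γ ⊗ X.obj ⟶ Y.obj at f g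
    change Γ ⊗ Y.obj ⟶ Z.obj at h
    change _ ≫ _ ≫ Γ ◁ (f + g) ≫ h = (_ ≫ _ ≫ Γ ◁ f ≫ h) + (_ ≫ _ ≫ Γ ◁ g ≫ h)
    simp
  comp_add X Y Z f g h := by
    change Γ ⊗ X.obj ⟶ Y.obj at f
    change Γ ⊗ Y.obj ⟶ Z.obj at g h
    change _ ≫ _ ≫ Γ ◁ f ≫ (g + h) = (_ ≫ _ ≫ Γ ◁ f ≫ g) + (_ ≫ _ ≫ Γ ◁ f ≫ h)
    simp

/-- `C ⋊ S`: the idempotent completion of `C ⋊₀ S`. Its objects are pairs `(X, p)`. -/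
abbrev Completed : Type max u v := Idempotents.Karoubi (Pre Γ)

end Category

section Grade

variable (𝔽 : Type w) [Field 𝔽] {C : Type u} [Category.{v} C] [Abelian C] [Linear 𝔽 C]
  [MonoidalCategory C] [MonoidalPreadditive C] [MonoidalLinear 𝔽 C] [BraidedCategory C]
  [RigidCategory C] [BTC.RibbonCategory C] [BTC.IsBTC 𝔽 C]
  {Γ : C} [MonObj Γ] [ComonObj Γ]

/-- The idempotent `p` of an object `(X, p)`, as a morphism of `C`. -/
def idem (Y : Completed Γ) : Γ ⊗ Y.X.obj ⟶ Y.X.obj := Y.p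

/-- `d(X, p) = Tr_X(p ∘ (η ⊗ id_X))`. -/
def dim (Y : Completed Γ) : 𝔽 :=
  BTC.unitScalar 𝔽 (BTC.trace ((λ_ Y.X.obj).inv ≫ MonObj.one ▷ Y.X.obj ≫ idem Y))

/-- `∂(X, p) = d(X, p)⁻¹ (id_Γ ⊗ Tr_X)(c_{Γ,X}⁻¹ c_{X,Γ}⁻¹ (id_Γ ⊗ p) (Δ ⊗ id_X))`. -/
def grade (Y : Completed Γ) : Γ ⟶ Γ :=
  (dim 𝔽 Y)⁻¹ • BTC.partialTrace (X := Y.X.obj)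
    (ComonObj.comul ▷ Y.X.obj ≫ (α_ Γ Γ Y.X.obj).hom ≫ Γ ◁ idem Y ≫
      (β_ Y.X.obj Γ).inv ≫ (β_ Γ Y.X.obj).inv)

end Grade

end CrossedProduct

end

/-! The idempotent of `Γ ⊗ X` induced by `p` splits in `C` as a `Γ`-comodule `(M, δ)`, a `Model` of
`(X, p)`. Since `Δ ≫ μ` is the scalar `|G₀|`, averaging turns any endomorphism of `M` into a
comodule endomorphism. Together with semisimplicity of `C` this yields Schur's lemma: if `(X, p)` is
simple, comodule endomorphisms of `M` are scalars (`Model.exists_eq_smul_id`).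

Following `δ` by the inverse double braiding gives a second coaction `δ'`. Pairing `δ`, twisted by a
right translation `R g`, with `δ'` gives a comodule endomorphism `monodromyEnd δ (R g)`, after which
`δ'` and `δ ≫ R g ▷ M` agree. These endomorphisms are scalars and add up to `|G₀|`, so one of them
is non-zero, and for that `g` one gets `δ' = δ ≫ R g ▷ M` (`Model.exists_coact_om_eq`). In the
partial trace defining `∂(X, p)` the double braiding may then be replaced by `R g`. What remains is
`d(X, p) R g`, because `Hom(Γ, 𝟙)` is spanned by `ε`. Hence the grade is a right translation, which
is an algebra automorphism.

For `d(X, p) ≠ 0`, the form `(s, t) ↦ tr(avg s ≫ t)` is symmetric, and `𝟙 M` is the average of an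
endomorphism of trace `d(X, p)`. Every average is a scalar, so `d(X, p) = 0` would make all traces
on `M` vanish, which semisimplicity forbids. The symmetry needs a trivial twist on `Γ`, and this is
what admissibility supplies: the twist is an involution of `Γ`, and its `-1` part would have
negative dimension. -/

noncomputable section

namespace CrossedProduct

open MonObj ComonObj

/-! ### Calculus of the endofunctor `Γ ⊗ -` for a commutative Frobenius algebra `Γ` -/

/-- A commutative, cocommutative Frobenius algebra whose self-braiding is symmetric. -/
structure IsSymmFrobenius {C : Type u} [Category.{v} C] [MonoidalCategory C] [BraidedCategory C]
    (Γ : C) [MonObj Γ] [ComonObj Γ] : Prop where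
  braiding_braiding : (β_ Γ Γ).hom ≫ (β_ Γ Γ).hom = 𝟙 (Γ ⊗ Γ)
  braiding_mul : (β_ Γ Γ).hom ≫ μ[Γ] = μ[Γ]
  comul_braiding : Δ[Γ] ≫ (β_ Γ Γ).hom = Δ[Γ]
  mul_comul_left : μ[Γ] ≫ Δ[Γ] = Γ ◁ Δ[Γ] ≫ (α_ Γ Γ Γ).inv ≫ μ[Γ] ▷ Γ
  mul_comul_right : μ[Γ] ≫ Δ[Γ] = Δ[Γ] ▷ Γ ≫ (α_ Γ Γ Γ).hom ≫ Γ ◁ μ[Γ]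

section Calculus

variable {C : Type u} [Category.{v} C] [MonoidalCategory C] (Γ : C)

/-- The comultiplication of the comonad `Γ ⊗ -`. -/
def cm [ComonObj Γ] (X : C) : Γ ⊗ X ⟶ Γ ⊗ (Γ ⊗ X) := Δ[Γ] ▷ X ≫ (α_ Γ Γ X).hom

/-- The counit of the comonad `Γ ⊗ -`. -/
def cu [ComonObj Γ] (X : C) : Γ ⊗ X ⟶ X := ε[Γ] ▷ X ≫ (λ_ X).hom

/-- The multiplication of the monad `Γ ⊗ -`. -/
def ml [MonObj Γ] (X : C) : Γ ⊗ (Γ ⊗ X) ⟶ Γ ⊗ X := (α_ Γ Γ X).inv ≫ μ[Γ] ▷ X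

/-- The unit of the monad `Γ ⊗ -`. -/
def un [MonObj Γ] (X : C) : X ⟶ Γ ⊗ X := (λ_ X).inv ≫ η[Γ] ▷ X

/-- The Frobenius pairing acting on `Γ ⊗ Γ ⊗ X`. -/
def kp [MonObj Γ] [ComonObj Γ] (X : C) : Γ ⊗ (Γ ⊗ X) ⟶ X := ml Γ X ≫ cu Γ X

/-- The self-braiding of `Γ` acting on `Γ ⊗ Γ ⊗ X`. -/
def sw [BraidedCategory C] (X : C) : Γ ⊗ (Γ ⊗ X) ⟶ Γ ⊗ (Γ ⊗ X) :=
  (α_ Γ Γ X).inv ≫ (β_ Γ Γ).hom ▷ X ≫ (α_ Γ Γ X).hom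

/-- The inverse double braiding of `Γ` with `X`. -/
def om [BraidedCategory C] (X : C) : Γ ⊗ X ⟶ Γ ⊗ X := (β_ X Γ).inv ≫ (β_ Γ X).inv

variable {Γ} {X Y : C}

theorem cm_naturality [ComonObj Γ] (f : X ⟶ Y) : Γ ◁ f ≫ cm Γ Y = cm Γ X ≫ Γ ◁ Γ ◁ f := by
  simp only [cm, whisker_exchange_assoc, Category.assoc]
  congr 1
  monoidal

theorem cu_naturality [ComonObj Γ] (f : X ⟶ Y) : Γ ◁ f ≫ cu Γ Y = cu Γ X ≫ f := by
  simp only [cu, whisker_exchange_assoc, Category.assoc]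
  congr 1
  monoidal

theorem ml_naturality [MonObj Γ] (f : X ⟶ Y) : Γ ◁ Γ ◁ f ≫ ml Γ Y = ml Γ X ≫ Γ ◁ f := by
  simp only [ml, Category.assoc, ← whisker_exchange]
  simp

theorem un_naturality [MonObj Γ] (f : X ⟶ Y) : f ≫ un Γ Y = un Γ X ≫ Γ ◁ f := by
  simp only [un, Category.assoc, ← whisker_exchange]
  simp

theorem kp_naturality [MonObj Γ] [ComonObj Γ] (f : X ⟶ Y) :
    Γ ◁ Γ ◁ f ≫ kp Γ Y = kp Γ X ≫ f := by
  simp only [kp, reassoc_of% (ml_naturality (Γ := Γ)), cu_naturality, Category.assoc]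

theorem om_naturality [BraidedCategory C] (f : X ⟶ Y) :
    Γ ◁ f ≫ om Γ Y = om Γ X ≫ Γ ◁ f := by
  simp [om]

theorem cm_cm [ComonObj Γ] (X : C) :
    cm Γ X ≫ cm Γ (Γ ⊗ X) = cm Γ X ≫ Γ ◁ cm Γ X := by
  have := congrArg (· ▷ X) (comul_assoc Γ)
  simp only [comp_whiskerRight] at this
  simp only [cm, MonoidalCategory.whiskerLeft_comp, Category.assoc,
    ← associator_naturality_middle_assoc, reassoc_of% this, ← associator_naturality_left_assoc]
  simp

@[simp]
theorem cm_cu [ComonObj Γ] (X : C) : cm Γ X ≫ cu Γ (Γ ⊗ X) = 𝟙 _ := by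
  have := congrArg (· ▷ X) (counit_comul Γ)
  simp only [comp_whiskerRight] at this
  simp only [cm, cu, Category.assoc, ← associator_naturality_left_assoc, reassoc_of% this]
  simp

@[simp]
theorem cm_whiskerLeft_cu [ComonObj Γ] (X : C) : cm Γ X ≫ Γ ◁ cu Γ X = 𝟙 _ := by
  have := congrArg (· ▷ X) (comul_counit Γ)
  simp only [comp_whiskerRight] at this
  simp only [cm, cu, MonoidalCategory.whiskerLeft_comp, Category.assoc,
    ← associator_naturality_middle_assoc, reassoc_of% this]
  simp

@[simp]
theorem un_ml [MonObj Γ] (X : C) : un Γ (Γ ⊗ X) ≫ ml Γ X = 𝟙 _ := by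
  have := congrArg (· ▷ X) (one_mul Γ)
  simp only [comp_whiskerRight] at this
  simp only [un, ml, Category.assoc, associator_inv_naturality_left_assoc, this]
  simp

@[simp]
theorem whiskerLeft_un_ml [MonObj Γ] (X : C) : Γ ◁ un Γ X ≫ ml Γ X = 𝟙 _ := by
  have := congrArg (· ▷ X) (mul_one Γ)
  simp only [comp_whiskerRight] at this
  simp only [un, ml, MonoidalCategory.whiskerLeft_comp, Category.assoc,
    associator_inv_naturality_middle_assoc, this]
  simp

theorem whiskerRight_cm [ComonObj Γ] {R : Γ ⟶ Γ} (hR : R ≫ Δ[Γ] = Δ[Γ] ≫ (R ⊗ₘ R)) (X : C) :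
    R ▷ X ≫ cm Γ X = cm Γ X ≫ R ▷ (Γ ⊗ X) ≫ Γ ◁ R ▷ X := by
  have := congrArg (· ▷ X) hR
  simp only [comp_whiskerRight] at this
  simp only [cm, reassoc_of% this, MonoidalCategory.tensorHom_def, comp_whiskerRight, Category.assoc]
  simp

section Braided

variable [BraidedCategory C]

/-- The pairing passes through a strand of `Γ`. -/
theorem sw_whiskerLeft_sw_kp [MonObj Γ] [ComonObj Γ] (X : C) :
    sw Γ (Γ ⊗ X) ≫ Γ ◁ sw Γ X ≫ kp Γ (Γ ⊗ X) = Γ ◁ kp Γ X := by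
  have h := BraidedCategory.braiding_naturality_right Γ (μ[Γ] ≫ ε[Γ])
  rw [BraidedCategory.braiding_tensor_right_hom] at h
  have h' := congrArg (fun f => (α_ Γ (Γ ⊗ Γ) X).inv ≫ (f ≫ (λ_ Γ).hom) ▷ X) h
  simp only [Category.assoc, comp_whiskerRight, braiding_tensorUnit_right, Iso.inv_hom_id,
    Category.comp_id] at h'
  trans Γ ◁ (α_ Γ Γ X).inv ≫ (α_ Γ (Γ ⊗ Γ) X).inv ≫
    (Γ ◁ (μ[Γ] ≫ ε[Γ])) ▷ X ≫ (ρ_ Γ).hom ▷ X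
  · rw [h']
    simp only [sw, kp, ml, cu]
    monoidal
  · simp only [kp, ml, cu]
    monoidal

theorem om_cu [ComonObj Γ] (X : C) : om Γ X ≫ cu Γ X = cu Γ X := by
  rw [cu, om, Category.assoc, ← BraidedCategory.braiding_inv_naturality_right_assoc,
    ← BraidedCategory.braiding_inv_naturality_left_assoc]
  simp

/-- By the hexagons the `Γ`-strand encircles both factors; its monodromy with the inner `Γ` is
trivial, so only the one with `X` is left. -/
theorem om_tensor (hs : (β_ Γ Γ).hom ≫ (β_ Γ Γ).hom = 𝟙 (Γ ⊗ Γ)) (X : C) :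
    om Γ (Γ ⊗ X) = sw Γ X ≫ Γ ◁ om Γ X ≫ sw Γ X := by
  have hi : (β_ Γ Γ).inv = (β_ Γ Γ).hom := by
    rw [← cancel_mono (β_ Γ Γ).hom, hs, Iso.inv_hom_id]
  simp [om, sw, BraidedCategory.braiding_tensor_left_inv,
    BraidedCategory.braiding_tensor_right_inv, hi]

theorem om_comul [ComonObj Γ] (X : C) :
    om Γ X ≫ Δ[Γ] ▷ X = Δ[Γ] ▷ X ≫ (β_ X (Γ ⊗ Γ)).inv ≫ (β_ (Γ ⊗ Γ) X).inv := by
  rw [BraidedCategory.braiding_inv_naturality_left_assoc,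
    BraidedCategory.braiding_inv_naturality_right, om, Category.assoc]

/-- The double braiding of `Γ ⊗ Γ` with `X` when `Γ` is transparent to itself. -/
theorem om_tensor_left (hs : (β_ Γ Γ).hom ≫ (β_ Γ Γ).hom = 𝟙 (Γ ⊗ Γ)) (X : C) :
    (β_ X (Γ ⊗ Γ)).inv ≫ (β_ (Γ ⊗ Γ) X).inv ≫ (α_ Γ Γ X).hom =
      (α_ Γ Γ X).hom ≫ Γ ◁ om Γ X ≫ sw Γ X ≫ Γ ◁ om Γ X ≫ sw Γ X := by
  have hi : (β_ Γ Γ).inv = (β_ Γ Γ).hom := by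
    rw [← cancel_mono (β_ Γ Γ).hom, hs, Iso.inv_hom_id]
  have h := om_naturality (Γ := Γ) (β_ Γ X).inv
  have h1 : om Γ (X ⊗ Γ) = (α_ Γ X Γ).inv ≫ om Γ X ▷ Γ ≫ (α_ Γ X Γ).hom := by
    simp only [om, BraidedCategory.braiding_tensor_left_inv,
      BraidedCategory.braiding_tensor_right_inv, hi, comp_whiskerRight, Category.assoc,
      Iso.inv_hom_id_assoc]
    rw [← MonoidalCategory.whiskerLeft_comp_assoc X, hs]
    simp
  rw [om_tensor hs, h1] at h
  have h2 : Γ ◁ om Γ X ≫ sw Γ X ≫ Γ ◁ om Γ X ≫ sw Γ X =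
      Γ ◁ (β_ X Γ).inv ≫ ((α_ Γ X Γ).inv ≫ om Γ X ▷ Γ ≫ (α_ Γ X Γ).hom) ≫ Γ ◁ (β_ Γ X).inv := by
    rw [← h, ← MonoidalCategory.whiskerLeft_comp_assoc]
    rfl
  rw [h2]
  simp only [om, BraidedCategory.braiding_tensor_left_inv,
    BraidedCategory.braiding_tensor_right_inv, Category.assoc, comp_whiskerRight]
  simp

theorem sw_sw (hs : (β_ Γ Γ).hom ≫ (β_ Γ Γ).hom = 𝟙 (Γ ⊗ Γ)) (X : C) :
    sw Γ X ≫ sw Γ X = 𝟙 _ := by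
  have := congrArg (· ▷ X) hs
  simp only [comp_whiskerRight] at this
  simp [sw, reassoc_of% this]

end Braided

section Frobenius

variable [BraidedCategory C] [MonObj Γ] [ComonObj Γ] (hΓ : IsSymmFrobenius Γ)

include hΓ

theorem IsSymmFrobenius.cm_sw (X : C) : cm Γ X ≫ sw Γ X = cm Γ X := by
  have := congrArg (· ▷ X) hΓ.comul_braiding
  simp only [comp_whiskerRight] at this
  simp [sw, cm, reassoc_of% this]

/-- Naturality moves `Δ` through the double braiding, leaving two `Γ`-strands that encircle `X`.
Cocommutativity absorbs the surplus crossing. -/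
theorem IsSymmFrobenius.om_cm (X : C) :
    om Γ X ≫ cm Γ X = cm Γ X ≫ Γ ◁ om Γ X ≫ sw Γ X ≫ Γ ◁ om Γ X := by
  conv_lhs => rw [← hΓ.cm_sw]
  rw [cm, Category.assoc, reassoc_of% om_comul,
    reassoc_of% om_tensor_left hΓ.braiding_braiding, sw_sw hΓ.braiding_braiding, Category.comp_id,
    Category.assoc]

theorem IsSymmFrobenius.ml_cm_left (X : C) :
    Γ ◁ cm Γ X ≫ ml Γ (Γ ⊗ X) = ml Γ X ≫ cm Γ X := by
  have := congrArg (· ▷ X) hΓ.mul_comul_left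
  simp only [comp_whiskerRight] at this
  simp only [ml, cm, Category.assoc, reassoc_of% this]
  monoidal

theorem IsSymmFrobenius.ml_cm_right (X : C) :
    cm Γ (Γ ⊗ X) ≫ Γ ◁ ml Γ X = ml Γ X ≫ cm Γ X := by
  have := congrArg (· ▷ X) hΓ.mul_comul_right
  simp only [comp_whiskerRight] at this
  simp only [ml, cm, Category.assoc, reassoc_of% this]
  monoidal

theorem IsSymmFrobenius.cm_kp_left (X : C) : Γ ◁ cm Γ X ≫ kp Γ (Γ ⊗ X) = ml Γ X := by
  rw [kp, reassoc_of% hΓ.ml_cm_left, cm_cu, Category.comp_id]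

theorem IsSymmFrobenius.cm_kp_right (X : C) : cm Γ (Γ ⊗ X) ≫ Γ ◁ kp Γ X = ml Γ X := by
  rw [kp, MonoidalCategory.whiskerLeft_comp, reassoc_of% hΓ.ml_cm_right, cm_whiskerLeft_cu,
    Category.comp_id]

/-- Sliding a twisted pairing past a strand. -/
theorem IsSymmFrobenius.cm_whiskerRight_kp (R : Γ ⟶ Γ) (X : C) :
    cm Γ (Γ ⊗ X) ≫ R ▷ (Γ ⊗ (Γ ⊗ X)) ≫ Γ ◁ sw Γ X ≫ kp Γ (Γ ⊗ X) =
      cm Γ (Γ ⊗ X) ≫ Γ ◁ R ▷ (Γ ⊗ X) ≫ Γ ◁ kp Γ X := by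
  have h : sw Γ (Γ ⊗ X) ≫ R ▷ (Γ ⊗ (Γ ⊗ X)) = Γ ◁ R ▷ (Γ ⊗ X) ≫ sw Γ (Γ ⊗ X) := by
    have := congrArg (· ▷ (Γ ⊗ X)) (BraidedCategory.braiding_naturality_right Γ R)
    simp only [comp_whiskerRight] at this
    simp only [sw, Category.assoc]
    rw [← associator_naturality_left, ← reassoc_of% this]
    simp
  rw [← sw_whiskerLeft_sw_kp, ← reassoc_of% h, reassoc_of% hΓ.cm_sw]

end Frobenius

end Calculus

end CrossedProduct

namespace CrossedProduct

open MonObj ComonObj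

/-! ### Comodules -/

section Comodule

variable {C : Type u} [Category.{v} C] [MonoidalCategory C] {Γ : C} [ComonObj Γ]

/-- A coaction of `Γ` on `M`. -/
structure IsCoaction {M : C} (δ : M ⟶ Γ ⊗ M) : Prop where
  coassoc : δ ≫ Γ ◁ δ = δ ≫ cm Γ M
  counit : δ ≫ cu Γ M = 𝟙 M

/-- `f` is an endomorphism of the comodule `(M, δ)`. -/
def IsComoduleEnd {M : C} (δ : M ⟶ Γ ⊗ M) (f : M ⟶ M) : Prop := f ≫ δ = δ ≫ Γ ◁ f

variable [MonObj Γ]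

/-- The action of the Frobenius algebra `Γ` determined by a coaction. -/
def act {M : C} (δ : M ⟶ Γ ⊗ M) : Γ ⊗ M ⟶ M := Γ ◁ δ ≫ kp Γ M

/-- Averaging an endomorphism over a coaction. -/
def avg {M : C} (δ : M ⟶ Γ ⊗ M) (s : M ⟶ M) : M ⟶ M := δ ≫ Γ ◁ s ≫ act δ

variable {M : C} {δ : M ⟶ Γ ⊗ M}

theorem IsComoduleEnd.whiskerLeft_act {f : M ⟶ M} (hf : IsComoduleEnd δ f) :
    Γ ◁ f ≫ act δ = act δ ≫ f := by
  have h := congrArg (Γ ◁ ·) hf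
  simp only [MonoidalCategory.whiskerLeft_comp] at h
  rw [act, reassoc_of% h, kp_naturality, Category.assoc]

theorem IsComoduleEnd.comp_avg_comp {f : M ⟶ M} (hf : IsComoduleEnd δ f) (t : M ⟶ M) :
    f ≫ avg δ t ≫ f = avg δ (f ≫ t ≫ f) := by
  simp only [avg, MonoidalCategory.whiskerLeft_comp, Category.assoc, hf.whiskerLeft_act]
  rw [← Category.assoc, hf, Category.assoc]

theorem IsCoaction.avg_id (hδ : IsCoaction δ) : avg δ (𝟙 M) = δ ≫ cm Γ M ≫ kp Γ M := by
  rw [avg, act, MonoidalCategory.whiskerLeft_id, Category.id_comp, reassoc_of% hδ.coassoc]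

variable [BraidedCategory C] (hΓ : IsSymmFrobenius Γ)

include hΓ

/-- The Frobenius relation on comodules. With `IsCoaction.cm_whiskerLeft_act` it makes `act δ` a
comodule map from the cofree comodule, which is why averages are comodule endomorphisms. -/
theorem IsCoaction.act_comp (hδ : IsCoaction δ) : act δ ≫ δ = Γ ◁ δ ≫ ml Γ M := by
  have h := congrArg (Γ ◁ ·) hδ.coassoc
  simp only [MonoidalCategory.whiskerLeft_comp] at h
  rw [act, Category.assoc, ← kp_naturality, reassoc_of% h, hΓ.cm_kp_left]

theorem IsCoaction.cm_whiskerLeft_act (hδ : IsCoaction δ) :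
    cm Γ M ≫ Γ ◁ act δ = act δ ≫ δ := by
  rw [hδ.act_comp hΓ, act, MonoidalCategory.whiskerLeft_comp, ← reassoc_of% @cm_naturality,
    hΓ.cm_kp_right]

theorem IsCoaction.isComoduleEnd_avg (hδ : IsCoaction δ) (s : M ⟶ M) :
    IsComoduleEnd δ (avg δ s) := by
  rw [IsComoduleEnd]
  simp only [avg, MonoidalCategory.whiskerLeft_comp, Category.assoc]
  rw [reassoc_of% hδ.coassoc, ← hδ.cm_whiskerLeft_act hΓ, reassoc_of% @cm_naturality]

/-- The coactions `δ` and `δ ≫ om Γ M` commute up to exchanging the two `Γ`-strands, by naturality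
of the monodromy along `δ` and cocommutativity. -/
theorem IsCoaction.om_comp_whiskerLeft (hδ : IsCoaction δ) :
    (δ ≫ om Γ M) ≫ Γ ◁ δ = δ ≫ Γ ◁ (δ ≫ om Γ M) ≫ sw Γ M := by
  rw [Category.assoc, ← om_naturality, reassoc_of% hδ.coassoc, om_tensor hΓ.braiding_braiding,
    reassoc_of% hΓ.cm_sw, MonoidalCategory.whiskerLeft_comp, Category.assoc,
    reassoc_of% hδ.coassoc]

theorem IsCoaction.comp_om (hδ : IsCoaction δ) : IsCoaction (δ ≫ om Γ M) where
  coassoc := by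
    conv_lhs => rw [MonoidalCategory.whiskerLeft_comp, ← Category.assoc,
      hδ.om_comp_whiskerLeft hΓ]
    rw [Category.assoc, Category.assoc, Category.assoc, hΓ.om_cm, MonoidalCategory.whiskerLeft_comp,
      Category.assoc, reassoc_of% hδ.coassoc]
  counit := by rw [Category.assoc, om_cu, hδ.counit]

/-- The endomorphism pairing a coaction with its monodromy, twisted by `R`. -/
def monodromyEnd (δ : M ⟶ Γ ⊗ M) (R : Γ ⟶ Γ) : M ⟶ M :=
  δ ≫ R ▷ M ≫ Γ ◁ (δ ≫ om Γ M) ≫ kp Γ M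

theorem IsCoaction.monodromyEnd_comp (hδ : IsCoaction δ) (R : Γ ⟶ Γ) :
    monodromyEnd δ R ≫ δ = δ ≫ Γ ◁ (δ ≫ om Γ M) ≫ cm Γ (Γ ⊗ M) ≫ Γ ◁ R ▷ (Γ ⊗ M) ≫
      Γ ◁ kp Γ M := by
  have h := congrArg (Γ ◁ ·) (hδ.om_comp_whiskerLeft hΓ)
  simp only [MonoidalCategory.whiskerLeft_comp, Category.assoc] at h
  rw [← hΓ.cm_whiskerRight_kp, monodromyEnd]
  simp only [MonoidalCategory.whiskerLeft_comp, Category.assoc]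
  rw [← kp_naturality, reassoc_of% h, ← whisker_exchange_assoc, reassoc_of% hδ.coassoc,
    ← whisker_exchange_assoc, ← whisker_exchange_assoc, reassoc_of% @cm_naturality,
    reassoc_of% @cm_naturality]

theorem IsCoaction.isComoduleEnd_monodromyEnd (hδ : IsCoaction δ) (R : Γ ⟶ Γ) :
    IsComoduleEnd δ (monodromyEnd δ R) := by
  rw [IsComoduleEnd, hδ.monodromyEnd_comp hΓ, monodromyEnd]
  have h : Γ ◁ R ▷ M ≫ Γ ◁ Γ ◁ (δ ≫ om Γ M) = Γ ◁ Γ ◁ (δ ≫ om Γ M) ≫ Γ ◁ R ▷ (Γ ⊗ M) := by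
    simp only [← MonoidalCategory.whiskerLeft_comp, whisker_exchange]
  generalize δ ≫ om Γ M = δ' at h ⊢
  rw [MonoidalCategory.whiskerLeft_comp Γ δ, MonoidalCategory.whiskerLeft_comp Γ (R ▷ M),
    MonoidalCategory.whiskerLeft_comp Γ (Γ ◁ δ'), reassoc_of% hδ.coassoc,
    reassoc_of% h, reassoc_of% @cm_naturality]

/-- Coassociativity of the monodromy coaction on one side and comultiplicativity of `R` on the other
bring both composites to the same expression, in which the pairing has become the multiplication
`ml`. -/
theorem IsCoaction.monodromyEnd_comp_om (hδ : IsCoaction δ) {R : Γ ⟶ Γ}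
    (hR : R ≫ Δ[Γ] = Δ[Γ] ≫ (R ⊗ₘ R)) :
    monodromyEnd δ R ≫ δ ≫ om Γ M = monodromyEnd δ R ≫ δ ≫ R ▷ M := by
  rw [← Category.assoc _ δ (R ▷ M), hδ.monodromyEnd_comp hΓ]
  have h1 : Γ ◁ kp Γ M ≫ R ▷ M = R ▷ (Γ ⊗ Γ ⊗ M) ≫ Γ ◁ kp Γ M := whisker_exchange _ _
  have h2 : Γ ◁ R ▷ (Γ ⊗ M) ≫ R ▷ (Γ ⊗ Γ ⊗ M) = R ▷ (Γ ⊗ Γ ⊗ M) ≫ Γ ◁ R ▷ (Γ ⊗ M) :=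
    whisker_exchange _ _
  have h := congrArg (Γ ◁ ·) (hδ.comp_om hΓ).coassoc
  simp only [MonoidalCategory.whiskerLeft_comp] at h
  simp only [Category.assoc, h1, reassoc_of% h2]
  rw [← reassoc_of% whiskerRight_cm hR, hΓ.cm_kp_right, monodromyEnd]
  simp only [Category.assoc, ← kp_naturality]
  simp only [MonoidalCategory.whiskerLeft_comp, Category.assoc] at h ⊢
  rw [reassoc_of% h, hΓ.cm_kp_left]
  simp only [← whisker_exchange_assoc]

end Comodule

end CrossedProduct

/-! ### Traces and partial traces in ribbon categories -/

namespace BTC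

section BraidedTrace

variable {C : Type u} [Category.{v} C] [MonoidalCategory C] [BraidedCategory C]

/-- The trace of an endomorphism of `X` closed up with the braiding, without a twist. -/
def braidedTrace (X D : C) [ExactPairing X D] (f : X ⟶ X) : 𝟙_ C ⟶ 𝟙_ C :=
  η_ X D ≫ f ▷ D ≫ (β_ X D).hom ≫ ε_ X D

/-- A morphism slides around the loop by way of its mate. Since the two duals are arbitrary, the
lemma also shows that the trace does not depend on the chosen dual. -/
theorem braidedTrace_comp_comm {X Y D D' : C} [ExactPairing X D] [ExactPairing Y D']
    (f : X ⟶ Y) (g : Y ⟶ X) :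
    braidedTrace X D (f ≫ g) = braidedTrace Y D' (g ≫ f) := by
  obtain ⟨φ, h1, h2⟩ : ∃ φ : D' ⟶ D, η_ Y D' ≫ Y ◁ φ = η_ X D ≫ f ▷ D ∧
      φ ▷ X ≫ ε_ X D = D' ◁ f ≫ ε_ Y D' := by
    let _ : HasRightDual X := ⟨D⟩
    let _ : HasRightDual Y := ⟨D'⟩
    exact ⟨fᘁ, coevaluation_comp_rightAdjointMate f, rightAdjointMate_comp_evaluation f⟩
  rw [braidedTrace, comp_whiskerRight, Category.assoc, ← reassoc_of% h1,
    whisker_exchange_assoc, BraidedCategory.braiding_naturality_right_assoc, h2,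
    ← BraidedCategory.braiding_naturality_left_assoc, braidedTrace, comp_whiskerRight,
    Category.assoc]

theorem braiding_slide (X : C) {P Q : C} (e : P ⊗ Q ⟶ 𝟙_ C) :
    (α_ X P Q).inv ≫ (β_ X P).hom ▷ Q ≫ (α_ P X Q).hom ≫ P ◁ (β_ X Q).hom ≫
      (α_ P Q X).inv ≫ e ▷ X ≫ (λ_ X).hom = X ◁ e ≫ (ρ_ X).hom := by
  have h := BraidedCategory.braiding_naturality_right X e
  rw [BraidedCategory.braiding_tensor_right_hom] at h
  simp only [Category.assoc] at h
  rw [← braiding_leftUnitor, reassoc_of% h]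

/-- Unlinks two nested loops: the double braiding, which is what the twist of a tensor product
contributes, cancels the crossings between the `A`- and `M`-strands. Each cancellation is a
`braiding_slide` of one strand past a closed cap. -/
theorem evaluation_tensor (A M A' M' : C) [ExactPairing A A'] [ExactPairing M M'] :
    ((β_ A M).hom ≫ (β_ M A).hom) ▷ (M' ⊗ A') ≫ (β_ (A ⊗ M) (M' ⊗ A')).hom ≫
      ε_ (A ⊗ M) (M' ⊗ A') =
    𝟙 _ ⊗≫ A ◁ ((β_ M M').hom ≫ ε_ M M') ▷ A' ⊗≫ (β_ A A').hom ≫ ε_ A A' := by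
  rw [ExactPairing.tensor_evaluation, BraidedCategory.braiding_tensor_right_hom,
    BraidedCategory.braiding_tensor_left_hom, BraidedCategory.braiding_tensor_left_hom]
  calc
    _ = 𝟙 _ ⊗≫ (β_ A M).hom ▷ M' ▷ A' ⊗≫ ((α_ M A M').inv ≫ (β_ M A).hom ▷ M' ≫
          (α_ A M M').hom ≫ A ◁ (β_ M M').hom ≫ (α_ A M' M).inv ≫ (β_ A M').hom ▷ M ≫
          (α_ M' A M).hom) ▷ A' ⊗≫ M' ◁ A ◁ (β_ M A').hom ⊗≫ M' ◁ (β_ A A').hom ▷ M ⊗≫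
          M' ◁ ε_ A A' ▷ M ⊗≫ ε_ M M' := by monoidal
    _ = 𝟙 _ ⊗≫ (β_ A M).hom ▷ M' ▷ A' ⊗≫ M ◁ (β_ A M').hom ▷ A' ⊗≫ (β_ M M').hom ▷ A ▷ A' ⊗≫
          M' ◁ ((α_ M A A').inv ≫ (β_ M A).hom ▷ A' ≫ (α_ A M A').hom ≫ A ◁ (β_ M A').hom ≫
          (α_ A A' M).inv ≫ ((β_ A A').hom ≫ ε_ A A') ▷ M ≫ (λ_ M).hom) ⊗≫ ε_ M M' := by
        rw [BraidedCategory.yang_baxter]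
        monoidal
    _ = 𝟙 _ ⊗≫ (β_ A M).hom ▷ M' ▷ A' ⊗≫ M ◁ (β_ A M').hom ▷ A' ⊗≫
          ((β_ M M').hom ▷ (A ⊗ A') ≫ (M' ⊗ M) ◁ ((β_ A A').hom ≫ ε_ A A')) ⊗≫
          ε_ M M' := by
        rw [braiding_slide]
        monoidal
    _ = 𝟙 _ ⊗≫ (β_ A M).hom ▷ M' ▷ A' ⊗≫ M ◁ (β_ A M').hom ▷ A' ⊗≫
          ((M ⊗ M') ◁ ((β_ A A').hom ≫ ε_ A A') ≫ ((β_ M M').hom ≫ ε_ M M') ▷ (𝟙_ C)) ⊗≫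
          𝟙 _ := by
        rw [← whisker_exchange]
        monoidal
    _ = 𝟙 _ ⊗≫ ((α_ A M M').inv ≫ (β_ A M).hom ▷ M' ≫ (α_ M A M').hom ≫ M ◁ (β_ A M').hom ≫
          (α_ M M' A).inv ≫ ((β_ M M').hom ≫ ε_ M M') ▷ A ≫ (λ_ A).hom) ▷ A' ⊗≫
          (β_ A A').hom ≫ ε_ A A' := by
        rw [whisker_exchange]
        monoidal
    _ = _ := by
        rw [braiding_slide]
        monoidal

end BraidedTrace

section Ribbon

variable {C : Type u} [Category.{v} C] [MonoidalCategory C] [BraidedCategory C]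
  [RigidCategory C] [RibbonCategory C]

open RibbonCategory

theorem trace_eq_braidedTrace {X : C} (D : C) [ExactPairing X D] (f : X ⟶ X) :
    trace f = braidedTrace X D (f ≫ (twist X).hom) := by
  rw [← Category.id_comp (f ≫ _), braidedTrace_comp_comm (D' := Xᘁ), Category.comp_id, trace,
    evBar, braidedTrace, comp_whiskerRight, Category.assoc]

theorem trace_comp_comm {X Y : C} (f : X ⟶ Y) (g : Y ⟶ X) : trace (f ≫ g) = trace (g ≫ f) := by
  rw [trace_eq_braidedTrace Xᘁ, trace_eq_braidedTrace Yᘁ, Category.assoc,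
    braidedTrace_comp_comm (D' := Yᘁ), Category.assoc, Category.assoc, twist_naturality]

/-- The trace over `A ⊗ M` may be taken first over `M`, then over `A`. The dual of `A` is left free
so that `Γ` can later serve as its own dual. -/
theorem trace_tensor (A' : C) {A M : C} [ExactPairing A A'] (f : A ⊗ M ⟶ A ⊗ M) :
    trace f = braidedTrace A A' (partialTrace f ≫ (twist A).hom) := by
  have h : (twist (A ⊗ M)).hom =
      ((twist A).hom ⊗ₘ (twist M).hom) ≫ (β_ A M).hom ≫ (β_ M A).hom := by
    rw [twist_tensor, BraidedCategory.braiding_naturality_assoc,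
      BraidedCategory.braiding_naturality]
  rw [trace_eq_braidedTrace (Mᘁ ⊗ A'), braidedTrace, h, ← Category.assoc f, comp_whiskerRight,
    Category.assoc, evaluation_tensor, ExactPairing.tensor_coevaluation, braidedTrace,
    partialTrace, evBar, MonoidalCategory.tensorHom_def']
  have e : (A ◁ ((β_ M Mᘁ).hom ≫ ε_ M Mᘁ)) ≫ (twist A).hom ▷ _ =
      (twist A).hom ▷ (M ⊗ Mᘁ) ≫ (A ◁ ((β_ M Mᘁ).hom ≫ ε_ M Mᘁ)) := whisker_exchange _ _
  calc
    _ = 𝟙 _ ⊗≫ η_ A A' ⊗≫ (A ◁ η_ M Mᘁ) ▷ A' ⊗≫ f ▷ Mᘁ ▷ A' ⊗≫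
          A ◁ (twist M).hom ▷ Mᘁ ▷ A' ⊗≫
          ((twist A).hom ▷ (M ⊗ Mᘁ) ≫ (A ◁ ((β_ M Mᘁ).hom ≫ ε_ M Mᘁ))) ▷ A' ⊗≫
          (β_ A A').hom ≫ ε_ A A' := by monoidal
    _ = _ := by
      rw [← e]
      monoidal

theorem twist_unit : (twist (𝟙_ C)).hom = 𝟙 _ := by
  have h := twist_naturality (λ_ (𝟙_ C)).hom
  rw [twist_tensor, MonoidalCategory.tensorHom_def] at h
  simp only [braiding_tensorUnit_left, Category.assoc, leftUnitor_naturality] at h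
  simp only [unitors_equal, Iso.hom_inv_id_assoc] at h
  -- On `𝟙 ⊗ 𝟙` the double braiding is trivial, so the twist of the unit is an invertible
  -- idempotent.
  rw [← cancel_mono (twist (𝟙_ C)).hom, Category.id_comp]
  simpa using h.symm

theorem partialTrace_comp_whiskerRight {A B B' X : C} (f : A ⊗ X ⟶ B ⊗ X) (u : B ⟶ B') :
    partialTrace (f ≫ u ▷ X) = partialTrace f ≫ u := by
  have h : B ◁ evBar X ≫ u ▷ 𝟙_ C = u ▷ (X ⊗ Xᘁ) ≫ B' ◁ evBar X := whisker_exchange _ _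
  simp only [partialTrace, Category.assoc]
  rw [← rightUnitor_naturality, reassoc_of% h]
  monoidal

theorem partialTrace_whiskerRight_comp {A A' B X : C} (u : A ⟶ A') (f : A' ⊗ X ⟶ B ⊗ X) :
    partialTrace (u ▷ X ≫ f) = u ≫ partialTrace f := by
  have h : A ◁ η_ X Xᘁ ≫ u ▷ (X ⊗ Xᘁ) = u ▷ 𝟙_ C ≫ A' ◁ η_ X Xᘁ := whisker_exchange _ _
  simp only [partialTrace]
  rw [rightUnitor_inv_naturality_assoc, ← reassoc_of% h]
  monoidal

theorem partialTrace_whiskerLeft {A B X : C} (Z : C) (f : A ⊗ X ⟶ B ⊗ X) :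
    partialTrace ((α_ Z A X).hom ≫ Z ◁ f ≫ (α_ Z B X).inv) = Z ◁ partialTrace f := by
  simp only [partialTrace]
  monoidal

theorem trace_eq_partialTrace {X : C} (f : X ⟶ X) :
    trace f = partialTrace ((λ_ X).hom ≫ f ≫ (λ_ X).inv) := by
  simp only [partialTrace, trace]
  monoidal

end Ribbon

end BTC

/-! ### Semisimplicity and non-vanishing traces -/

namespace BTC

section Semisimple

variable (𝔽 : Type w) [Field 𝔽] {C : Type u} [Category.{v} C] [Abelian C] [Linear 𝔽 C]
  [MonoidalCategory C] [MonoidalPreadditive C] [MonoidalLinear 𝔽 C] [BraidedCategory C]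
  [RigidCategory C] [RibbonCategory C] [IsBTC 𝔽 C]

include 𝔽 in
theorem exists_simple_decomposition (X : C) :
    ∃ (n : ℕ) (S : Fin n → C) (p : ∀ i, X ⟶ S i) (j : ∀ i, S i ⟶ X),
      (∀ i, Simple (S i)) ∧ (∀ i, j i ≫ p i = 𝟙 _) ∧ ∑ i, p i ≫ j i = 𝟙 X := by
  obtain ⟨n, S, b, hS, ⟨hb⟩, ⟨e⟩⟩ := IsBTC.semisimple (𝔽 := 𝔽) X
  refine ⟨n, S, fun i => e.hom ≫ b.π i, fun i => b.ι i ≫ e.inv, hS, fun i => by simp, ?_⟩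
  have h := IsBilimit.total hb
  calc _ = e.hom ≫ (∑ i, b.π i ≫ b.ι i) ≫ e.inv := by
        simp [Preadditive.sum_comp, Preadditive.comp_sum]
    _ = 𝟙 X := by rw [h]; simp

include 𝔽 in
theorem exists_retraction_of_simple {S Y : C} [Simple S] {f : S ⟶ Y} (hf : f ≠ 0) :
    ∃ r : Y ⟶ S, f ≫ r = 𝟙 S := by
  obtain ⟨n, T, p, j, hT, -, h⟩ := exists_simple_decomposition 𝔽 Y
  obtain ⟨i, hi⟩ : ∃ i, f ≫ p i ≠ 0 := by
    by_contra! hc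
    apply hf
    rw [← Category.comp_id f, ← h, Preadditive.comp_sum]
    exact Finset.sum_eq_zero fun i _ => by rw [← Category.assoc, hc i, zero_comp]
  have := hT i
  have := isIso_of_hom_simple hi
  exact ⟨p i ≫ inv (f ≫ p i), by rw [← Category.assoc, IsIso.hom_inv_id]⟩

include 𝔽 in
/-- Every morphism of a semisimple category is von Neumann regular. -/
theorem exists_comp_comp_eq_self {X Y : C} (f : X ⟶ Y) : ∃ t : Y ⟶ X, f ≫ t ≫ f = f := by
  classical
  obtain ⟨n, S, p, j, hS, -, h⟩ := exists_simple_decomposition 𝔽 X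
  -- The quasi-inverse is built up one simple summand at a time.
  have key : ∀ s : Finset (Fin n), ∃ t : Y ⟶ X, ∀ i ∈ s, j i ≫ f ≫ t ≫ f = j i ≫ f := by
    intro s
    induction s using Finset.induction_on with
    | empty => exact ⟨0, by simp⟩
    | insert i s _ ih =>
      obtain ⟨t, ht⟩ := ih
      by_cases hu : j i ≫ f - j i ≫ f ≫ t ≫ f = 0
      · refine ⟨t, fun k hk => ?_⟩
        rcases Finset.mem_insert.mp hk with rfl | hk
        · exact (sub_eq_zero.mp hu).symm
        · exact ht k hk
      · have := hS i
        obtain ⟨r, hr⟩ := exists_retraction_of_simple 𝔽 hu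
        -- The defect on `S i` is a split mono with retraction `r`. The correction multiplies each
        -- summand's defect by `r` and the `i`-th defect, so it repairs `i` and leaves alone the
        -- summands whose defect is already zero.
        have expand : ∀ k, j k ≫ f ≫ (t + (𝟙 Y - t ≫ f) ≫ r ≫ j i ≫ (𝟙 X - f ≫ t)) ≫ f =
            j k ≫ f ≫ t ≫ f + (j k ≫ f - j k ≫ f ≫ t ≫ f) ≫ r ≫
              (j i ≫ f - j i ≫ f ≫ t ≫ f) := by
          intro k
          simp
        refine ⟨t + (𝟙 Y - t ≫ f) ≫ r ≫ j i ≫ (𝟙 X - f ≫ t), fun k hk => ?_⟩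
        rw [expand]
        rcases Finset.mem_insert.mp hk with rfl | hk
        · rw [reassoc_of% hr]
          abel
        · rw [ht k hk, sub_self, zero_comp, add_zero]
  obtain ⟨t, ht⟩ := key Finset.univ
  refine ⟨t, ?_⟩
  rw [← Category.id_comp (f ≫ t ≫ f), ← h, Preadditive.sum_comp]
  calc _ = ∑ i, (p i ≫ j i) ≫ f :=
        Finset.sum_congr rfl fun i hi => by simp only [Category.assoc, ht i hi]
    _ = f := by rw [← Preadditive.sum_comp, h, Category.id_comp]

theorem unitScalar_smul (f : 𝟙_ C ⟶ 𝟙_ C) : unitScalar 𝔽 f • 𝟙 (𝟙_ C) = f :=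
  (Equiv.ofBijective _ (IsBTC.end_unit (𝔽 := 𝔽) (C := C))).apply_symm_apply f

theorem unitScalar_eq {f : 𝟙_ C ⟶ 𝟙_ C} {a : 𝔽} (h : f = a • 𝟙 (𝟙_ C)) : unitScalar 𝔽 f = a :=
  (IsBTC.end_unit (𝔽 := 𝔽) (C := C)).1 ((unitScalar_smul 𝔽 f).trans h)

include 𝔽 in
theorem id_unit_ne_zero : 𝟙 (𝟙_ C) ≠ 0 := fun h => one_ne_zero (α := 𝔽)
  ((IsBTC.end_unit (𝔽 := 𝔽) (C := C)).1 (by simp [h]))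

/-- The coevaluation of `S` has a retraction. By rigidity and Schur's lemma that retraction is a
multiple of the braided evaluation, so the loop on `S` cannot vanish; the twist only contributes a
non-zero scalar. -/
theorem trace_id_ne_zero_of_simple [IsAlgClosed 𝔽] (S : C) [Simple S] : trace (𝟙 S) ≠ 0 := by
  have := IsBTC.finite_hom (𝔽 := 𝔽) S S
  have hη : η_ S Sᘁ ≠ 0 := by
    intro h
    have := ExactPairing.evaluation_coevaluation S Sᘁ
    rw [h] at this
    apply id_nonzero S
    rw [← cancel_epi (λ_ S).hom, ← cancel_mono (ρ_ S).inv]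
    simpa using this.symm
  obtain ⟨t, ht⟩ := exists_comp_comp_eq_self 𝔽 (η_ S Sᘁ)
  have hc : η_ S Sᘁ ≫ t = 𝟙 _ := by
    have h1 := unitScalar_smul 𝔽 (η_ S Sᘁ ≫ t)
    rw [← Category.assoc, ← h1, Linear.smul_comp, Category.id_comp] at ht
    have h2 : (unitScalar 𝔽 (η_ S Sᘁ ≫ t) - 1) • η_ S Sᘁ = 0 := by rw [sub_smul, ht]; simp
    rw [smul_eq_zero_iff_left hη, sub_eq_zero] at h2
    rw [← h1, h2, one_smul]
  set q : Sᘁ ⊗ S ⟶ 𝟙_ C := (β_ S Sᘁ).inv ≫ t with hq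
  obtain ⟨a, ha⟩ : ∃ a : S ⟶ S, q = Sᘁ ◁ a ≫ ε_ S Sᘁ := by
    refine ⟨tensorLeftHomEquiv S S Sᘁ (𝟙_ C) q ≫ (ρ_ S).hom, ?_⟩
    have h := (tensorLeftHomEquiv S S Sᘁ (𝟙_ C)).symm_apply_apply q
    generalize tensorLeftHomEquiv S S Sᘁ (𝟙_ C) q = g at h ⊢
    rw [← h]
    change Sᘁ ◁ g ≫ _ = _
    monoidal
  obtain ⟨c, rfl⟩ := endomorphism_simple_eq_smul_id 𝔽 a
  obtain ⟨s, hs⟩ := endomorphism_simple_eq_smul_id 𝔽 (RibbonCategory.twist S).hom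
  have hs0 : s ≠ 0 := by
    rintro rfl
    apply id_nonzero S
    rw [← cancel_mono (RibbonCategory.twist S).hom, ← hs]
    simp
  have hne : η_ S Sᘁ ≫ (β_ S Sᘁ).hom ≫ ε_ S Sᘁ ≠ 0 := by
    intro h
    apply id_unit_ne_zero 𝔽 (C := C)
    have : t = c • (β_ S Sᘁ).hom ≫ ε_ S Sᘁ := by
      rw [← cancel_epi (β_ S Sᘁ).inv, ← hq, ha]
      simp
    rw [← hc, this, Linear.comp_smul, h, smul_zero]
  rw [trace, evBar, ← hs]
  simpa [hs0] using hne

theorem exists_trace_ne_zero [IsAlgClosed 𝔽] {X : C} (hX : 𝟙 X ≠ 0) :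
    ∃ s : X ⟶ X, trace s ≠ 0 := by
  obtain ⟨n, S, p, j, hS, hj, h⟩ := exists_simple_decomposition 𝔽 X
  obtain ⟨i⟩ : Nonempty (Fin n) := by
    by_contra hc
    rw [not_nonempty_iff] at hc
    exact hX (by rw [← h]; simp)
  have := hS i
  refine ⟨p i ≫ j i, ?_⟩
  rw [trace_comp_comm, hj]
  exact trace_id_ne_zero_of_simple 𝔽 (S i)

end Semisimple

end BTC

/-! ### Objects of the crossed product as comodules -/

namespace CrossedProduct

open MonObj ComonObj

section Model

variable {C : Type u} [Category.{v} C] [MonoidalCategory C] {Γ : C} [ComonObj Γ]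

/-- A `Γ`-comodule in `C` representing the object `(X, p)` of the crossed product: a splitting of
the idempotent comodule endomorphism of `Γ ⊗ X` determined by `p`. -/
structure Model (Y : Completed Γ) where
  M : C
  incl : M ⟶ Γ ⊗ Y.X.obj
  proj : Γ ⊗ Y.X.obj ⟶ M
  incl_proj : incl ≫ proj = 𝟙 M
  proj_incl : proj ≫ incl = cm Γ Y.X.obj ≫ Γ ◁ idem Y

theorem cm_whiskerLeft_idem (Y : Completed Γ) :
    cm Γ Y.X.obj ≫ Γ ◁ idem Y ≫ idem Y = idem Y := by
  have h := Y.idem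
  change (Δ[Γ] ▷ Y.X.obj ≫ (α_ Γ Γ Y.X.obj).hom ≫ Γ ◁ idem Y ≫ idem Y) = idem Y at h
  simpa [cm] using h

theorem exists_model [Preadditive C] [IsIdempotentComplete C] (Y : Completed Γ) :
    Nonempty (Model Y) := by
  obtain ⟨M, i, r, h1, h2⟩ := IsIdempotentComplete.idempotents_split (Γ ⊗ Y.X.obj)
    (cm Γ Y.X.obj ≫ Γ ◁ idem Y) (by
      rw [Category.assoc, reassoc_of% @cm_naturality, reassoc_of% @cm_cm,
        ← MonoidalCategory.whiskerLeft_comp, ← MonoidalCategory.whiskerLeft_comp,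
        cm_whiskerLeft_idem])
  exact ⟨⟨M, i, r, h1, h2⟩⟩

namespace Model

variable {Y : Completed Γ} (m : Model Y)

/-- The coaction on the comodule. -/
def coact : m.M ⟶ Γ ⊗ m.M := m.incl ≫ cm Γ _ ≫ Γ ◁ m.proj

/-- The map to `X` cogenerating the inclusion. -/
def toObj : m.M ⟶ Y.X.obj := m.incl ≫ cu Γ _

theorem cm_whiskerLeft_proj : cm Γ _ ≫ Γ ◁ m.proj = m.proj ≫ m.coact := by
  have h : (m.proj ≫ m.incl) ≫ cm Γ _ = cm Γ _ ≫ Γ ◁ (m.proj ≫ m.incl) := by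
    rw [m.proj_incl, Category.assoc, cm_naturality, reassoc_of% @cm_cm,
      ← MonoidalCategory.whiskerLeft_comp]
  rw [coact, ← Category.assoc, ← Category.assoc, h, Category.assoc,
    ← MonoidalCategory.whiskerLeft_comp, Category.assoc, m.incl_proj, Category.comp_id]

theorem coact_whiskerLeft_incl : m.coact ≫ Γ ◁ m.incl = m.incl ≫ cm Γ _ := by
  have h : (m.proj ≫ m.incl) ≫ cm Γ _ = cm Γ _ ≫ Γ ◁ (m.proj ≫ m.incl) := by
    rw [m.proj_incl, Category.assoc, cm_naturality, reassoc_of% @cm_cm,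
      ← MonoidalCategory.whiskerLeft_comp]
  rw [coact, Category.assoc, Category.assoc, ← MonoidalCategory.whiskerLeft_comp, ← h,
    Category.assoc, reassoc_of% m.incl_proj]

theorem isCoaction : IsCoaction m.coact where
  coassoc := by
    calc m.coact ≫ Γ ◁ m.coact = (m.incl ≫ cm Γ _ ≫ Γ ◁ m.proj) ≫ Γ ◁ m.coact := rfl
      _ = m.coact ≫ cm Γ m.M := by
        rw [Category.assoc, Category.assoc, ← MonoidalCategory.whiskerLeft_comp,
          ← m.cm_whiskerLeft_proj, MonoidalCategory.whiskerLeft_comp, ← reassoc_of% @cm_cm,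
          coact, Category.assoc, Category.assoc, cm_naturality]
  counit := by
    rw [coact, Category.assoc, Category.assoc, cu_naturality, reassoc_of% @cm_cu, m.incl_proj]

theorem coact_whiskerLeft_toObj : m.coact ≫ Γ ◁ m.toObj = m.incl := by
  rw [toObj, MonoidalCategory.whiskerLeft_comp, reassoc_of% m.coact_whiskerLeft_incl,
    cm_whiskerLeft_cu, Category.comp_id]

theorem proj_toObj : m.proj ≫ m.toObj = idem Y := by
  rw [toObj, reassoc_of% m.proj_incl, cu_naturality, reassoc_of% @cm_cu]

/-- Comodule endomorphisms `e` correspond to morphisms `proj ≫ e ≫ toObj` of the crossed product.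
The cofree extension of such a morphism recovers `e`, which makes the correspondence multiplicative
(`comp_end`) and injective (`end_ext`). -/
theorem cm_whiskerLeft_end {e : m.M ⟶ m.M} (he : IsComoduleEnd m.coact e) :
    cm Γ _ ≫ Γ ◁ (m.proj ≫ e ≫ m.toObj) = m.proj ≫ e ≫ m.incl := by
  rw [IsComoduleEnd] at he
  rw [MonoidalCategory.whiskerLeft_comp, reassoc_of% m.cm_whiskerLeft_proj,
    MonoidalCategory.whiskerLeft_comp, ← reassoc_of% he, m.coact_whiskerLeft_toObj]

theorem id_isComoduleEnd : IsComoduleEnd m.coact (𝟙 m.M) := by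
  simp [IsComoduleEnd]

theorem comp_end {e e' : m.M ⟶ m.M} (he : IsComoduleEnd m.coact e) :
    cm Γ _ ≫ Γ ◁ (m.proj ≫ e ≫ m.toObj) ≫ m.proj ≫ e' ≫ m.toObj =
      m.proj ≫ (e ≫ e') ≫ m.toObj := by
  rw [reassoc_of% m.cm_whiskerLeft_end he, reassoc_of% m.incl_proj, Category.assoc]

theorem end_ext {e e' : m.M ⟶ m.M} (he : IsComoduleEnd m.coact e)
    (he' : IsComoduleEnd m.coact e')
    (h : m.proj ≫ e ≫ m.toObj = m.proj ≫ e' ≫ m.toObj) : e = e' := by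
  have h1 := m.cm_whiskerLeft_end he
  rw [h, m.cm_whiskerLeft_end he'] at h1
  have h2 := congrArg (fun f => m.incl ≫ f ≫ m.proj) h1
  simpa [m.incl_proj, reassoc_of% m.incl_proj] using h2.symm

/-- An idempotent endomorphism of the comodule of a simple object is trivial. -/
theorem eq_zero_or_eq_id [Preadditive C] [MonoidalPreadditive C] (hY : Simple Y)
    {e : m.M ⟶ m.M} (he : IsComoduleEnd m.coact e) (hi : e ≫ e = e) : e = 0 ∨ e = 𝟙 m.M := by
  let q : Y.X ⟶ Y.X := (m.proj ≫ e ≫ m.toObj : Γ ⊗ Y.X.obj ⟶ Y.X.obj)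
  have comp : ∀ s t : Γ ⊗ Y.X.obj ⟶ Y.X.obj,
      @CategoryStruct.comp (Pre Γ) _ Y.X Y.X Y.X s t = cm Γ Y.X.obj ≫ Γ ◁ s ≫ t :=
    fun s t => by simp only [cm, Category.assoc]; rfl
  have hp : Y.p = m.proj ≫ 𝟙 m.M ≫ m.toObj := by
    rw [Category.id_comp, m.proj_toObj]; rfl
  have hqq : q ≫ q = q := by
    rw [comp]
    exact (m.comp_end he).trans (by rw [hi])
  have hpq : Y.p ≫ q = q := by
    rw [hp, comp]
    exact (m.comp_end m.id_isComoduleEnd).trans (by rw [Category.id_comp])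
  have hqp : q ≫ Y.p = q := by
    rw [hp, comp]
    exact (m.comp_end he).trans (by rw [Category.comp_id])
  -- The idempotent `q` cuts out a subobject `Z` of `Y`, which by simplicity is zero or everything.
  let Z : Completed Γ := ⟨Y.X, q, hqq⟩
  let f : Z ⟶ Y := ⟨q, by change q ≫ q ≫ Y.p = q; rw [hqp, hqq]⟩
  let g : Y ⟶ Z := ⟨q, by change Y.p ≫ q ≫ q = q; rw [hqq, hpq]⟩
  have hfg : f ≫ g = 𝟙 Z := Idempotents.Karoubi.Hom.ext hqq
  have : Mono f := mono_of_mono_fac hfg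
  by_cases hf : f = 0
  · left
    refine m.end_ext he (by simp [IsComoduleEnd]) ?_
    have h := congrArg Idempotents.Karoubi.Hom.f hf
    rw [zero_comp, comp_zero]
    exact h
  · right
    have : IsIso f := (Simple.mono_isIso_iff_nonzero f).2 hf
    have hgf : g ≫ f = 𝟙 Y := by
      rw [← cancel_epi f, ← Category.assoc, hfg, Category.id_comp, Category.comp_id]
    have h := congrArg Idempotents.Karoubi.Hom.f hgf
    change q ≫ q = Y.p at h
    rw [hqq] at h
    exact m.end_ext he m.id_isComoduleEnd (h.trans hp)

theorem id_ne_zero [Preadditive C] [MonoidalPreadditive C] (hY : Simple Y) : 𝟙 m.M ≠ 0 := by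
  intro h
  apply id_nonzero Y
  apply Idempotents.Karoubi.Hom.ext
  change idem Y = 0
  rw [← m.proj_toObj, ← Category.comp_id m.proj, h]
  simp

end Model

end Model

end CrossedProduct

/-! ### Symmetry of the trace form, Schur's lemma and the grade -/

namespace CrossedProduct

open MonObj ComonObj

section Trace

variable {C : Type u} [Category.{v} C] [MonoidalCategory C] [BraidedCategory C]
  {Γ : C} [MonObj Γ] [ComonObj Γ]

/-- The self-duality of a Frobenius algebra. -/
@[reducible]
def IsSymmFrobenius.exactPairing (hΓ : IsSymmFrobenius Γ) : ExactPairing Γ Γ where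
  coevaluation' := η[Γ] ≫ Δ[Γ]
  evaluation' := μ[Γ] ≫ ε[Γ]
  coevaluation_evaluation' := by
    rw [MonoidalCategory.whiskerLeft_comp, comp_whiskerRight, Category.assoc,
      ← reassoc_of% hΓ.mul_comul_left, counit_comul, MonObj.mul_one_assoc]
  evaluation_coevaluation' := by
    rw [MonoidalCategory.whiskerLeft_comp, comp_whiskerRight, Category.assoc,
      ← reassoc_of% hΓ.mul_comul_right, comul_counit, MonObj.one_mul_assoc]

variable [RigidCategory C] [BTC.RibbonCategory C]

/-- As `Γ` is its own dual with trivial twist, the `Γ`-loop closes with `η ≫ Δ` and `μ ≫ ε`;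
cocommutativity removes the crossing. -/
theorem IsSymmFrobenius.trace_tensor (hΓ : IsSymmFrobenius Γ)
    (hθ : (BTC.RibbonCategory.twist Γ).hom = 𝟙 Γ) {M : C} (h : Γ ⊗ M ⟶ Γ ⊗ M) :
    BTC.trace h = BTC.trace (un Γ M ≫ cm Γ M ≫ Γ ◁ h ≫ kp Γ M) := by
  let _ := hΓ.exactPairing
  rw [BTC.trace_tensor Γ, hθ, Category.comp_id, BTC.braidedTrace]
  change (η[Γ] ≫ Δ[Γ]) ≫ _ ≫ _ ≫ μ[Γ] ≫ ε[Γ] = _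
  rw [BraidedCategory.braiding_naturality_left_assoc, Category.assoc,
    reassoc_of% hΓ.comul_braiding, ← BTC.partialTrace_whiskerLeft,
    ← BTC.partialTrace_comp_whiskerRight, ← BTC.partialTrace_whiskerRight_comp,
    ← BTC.partialTrace_whiskerRight_comp, BTC.trace_eq_partialTrace]
  congr 1
  simp [un, cm, kp, ml, cu]

/-- Cyclicity turns the trace over `M` into one over `Γ ⊗ M`. Closing its `Γ`-loop with the
Frobenius pairing rebuilds an average, now of `t`. -/
theorem IsCoaction.trace_avg_comp (hΓ : IsSymmFrobenius Γ)
    (hθ : (BTC.RibbonCategory.twist Γ).hom = 𝟙 Γ) {M : C} {δ : M ⟶ Γ ⊗ M} (hδ : IsCoaction δ)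
    (s t : M ⟶ M) : BTC.trace (avg δ s ≫ t) = BTC.trace (avg δ t ≫ s) := by
  rw [avg, Category.assoc, BTC.trace_comp_comm, hΓ.trace_tensor hθ, BTC.trace_comp_comm _ s]
  congr 1
  have h1 : un Γ M ≫ cm Γ M ≫ Γ ◁ act δ = δ := by
    rw [hδ.cm_whiskerLeft_act hΓ, hδ.act_comp hΓ, ← reassoc_of% @un_naturality, un_ml,
      Category.comp_id]
  simp only [MonoidalCategory.whiskerLeft_comp, Category.assoc]
  rw [← reassoc_of% @cm_naturality, ← reassoc_of% @un_naturality, reassoc_of% h1]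
  rfl

end Trace

section Average

variable {𝔽 : Type w} [Field 𝔽] {C : Type u} [Category.{v} C] [Preadditive C] [Linear 𝔽 C]
  [MonoidalCategory C] [MonoidalPreadditive C] [MonoidalLinear 𝔽 C]
  {Γ : C} [MonObj Γ] [ComonObj Γ]

theorem IsCoaction.avg_id_eq_smul {n : 𝔽} (hn : Δ[Γ] ≫ μ[Γ] = n • 𝟙 Γ) {M : C}
    {δ : M ⟶ Γ ⊗ M} (hδ : IsCoaction δ) : avg δ (𝟙 M) = n • 𝟙 M := by
  have h := congrArg (· ▷ M) hn
  simp only [comp_whiskerRight] at h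
  have h' : cm Γ M ≫ kp Γ M = n • cu Γ M := by
    simp [cm, kp, ml, reassoc_of% h]
  rw [hδ.avg_id, h', Linear.comp_smul, hδ.counit]

end Average

section Linear

variable {𝔽 : Type w} [Field 𝔽] {C : Type u} [Category.{v} C] [Abelian C] [Linear 𝔽 C]
  [MonoidalCategory C] [MonoidalPreadditive C] [MonoidalLinear 𝔽 C] [BraidedCategory C]
  [RigidCategory C] [BTC.RibbonCategory C] [BTC.IsBTC 𝔽 C]
  {Γ : C} [MonObj Γ] [ComonObj Γ] {Y : Completed Γ} (m : Model Y)

/-- Schur's lemma: the endomorphisms of the comodule of a simple object are scalars. -/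
theorem Model.exists_eq_smul_id [IsAlgClosed 𝔽] (hΓ : IsSymmFrobenius Γ) {n : 𝔽} (hn0 : n ≠ 0)
    (hn : Δ[Γ] ≫ μ[Γ] = n • 𝟙 Γ) (hY : Simple Y) {e : m.M ⟶ m.M}
    (he : IsComoduleEnd m.coact e) : ∃ c : 𝔽, e = c • 𝟙 m.M := by
  have hfin : Module.Finite 𝔽 (m.M ⟶ m.M) := BTC.IsBTC.finite_hom m.M m.M
  have hfin' : Module.Finite 𝔽 (End m.M) := hfin
  have : Nontrivial (End m.M) := ⟨𝟙 m.M, 0, m.id_ne_zero hY⟩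
  obtain ⟨c, hc⟩ := spectrum.nonempty_of_isAlgClosed_of_finiteDimensional 𝔽
    (show End m.M from e)
  refine ⟨c, ?_⟩
  set f : m.M ⟶ m.M := c • 𝟙 m.M - e with hfdef
  have hf : IsComoduleEnd m.coact f := by
    rw [IsComoduleEnd] at he ⊢
    rw [hfdef, Preadditive.sub_comp, he,
      show Γ ◁ (c • 𝟙 m.M - e) = Γ ◁ (c • 𝟙 m.M) - Γ ◁ e from (tensorLeft Γ).map_sub,
      Preadditive.comp_sub, MonoidalLinear.whiskerLeft_smul]
    simp
  have hnu : ¬ IsIso f := by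
    intro hi
    apply hc
    refine ⟨⟨f, inv f, ?_, ?_⟩, ?_⟩
    · rw [End.mul_def, IsIso.inv_hom_id]; rfl
    · rw [End.mul_def, IsIso.hom_inv_id]; rfl
    · rw [Algebra.algebraMap_eq_smul_one]; rfl
  obtain ⟨t, ht⟩ := BTC.exists_comp_comp_eq_self 𝔽 f
  -- Because `f` is a comodule map, averaging keeps `t` a quasi-inverse of `f`, so `f ≫ t'` is an
  -- idempotent comodule endomorphism.
  set t' := n⁻¹ • avg m.coact t with ht'
  have htf : f ≫ t' ≫ f = f := by
    have h2 := hf.comp_avg_comp t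
    have h3 : avg m.coact f = n • f := by
      have h4 : f ≫ avg m.coact (𝟙 m.M) = avg m.coact f := by
        rw [avg, avg, MonoidalCategory.whiskerLeft_id, Category.id_comp, hf.whiskerLeft_act,
          ← Category.assoc, hf, Category.assoc, hf.whiskerLeft_act]
      rw [← h4, m.isCoaction.avg_id_eq_smul hn, Linear.comp_smul, Category.comp_id]
    rw [ht', Linear.smul_comp, Linear.comp_smul, h2, ht, h3, smul_smul, inv_mul_cancel₀ hn0,
      one_smul]
  have htend : IsComoduleEnd m.coact t' := by
    have := m.isCoaction.isComoduleEnd_avg hΓ t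
    rw [IsComoduleEnd] at this ⊢
    rw [ht', Linear.smul_comp, this, MonoidalLinear.whiskerLeft_smul, Linear.comp_smul]
  have hft : IsComoduleEnd m.coact (f ≫ t') := by
    rw [IsComoduleEnd] at hf htend ⊢
    rw [Category.assoc, htend, reassoc_of% hf, MonoidalCategory.whiskerLeft_comp]
  rcases m.eq_zero_or_eq_id hY hft (by rw [Category.assoc, reassoc_of% htf]) with h0 | h1
  · rw [← Category.assoc, h0, zero_comp] at htf
    exact (sub_eq_zero.mp htf.symm).symm
  · exfalso
    apply hnu
    -- A one-sided inverse is two-sided, since `End M` is finite-dimensional; this contradicts `c`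
    -- being in the spectrum.
    let L : (m.M ⟶ m.M) →ₗ[𝔽] (m.M ⟶ m.M) := Linear.rightComp 𝔽 m.M f
    have hinj : Function.Injective L := fun x y hxy => by
      have h : x ≫ f = y ≫ f := hxy
      rw [← Category.comp_id x, ← Category.comp_id y, ← h1, reassoc_of% h]
    obtain ⟨x, hx⟩ := LinearMap.injective_iff_surjective.mp hinj (𝟙 m.M)
    have hx' : x ≫ f = 𝟙 m.M := hx
    have : x = t' := by rw [← Category.comp_id x, ← h1, reassoc_of% hx']
    exact ⟨t', h1, this ▸ hx'⟩

/-- The monodromy of a simple comodule is implemented by one of the automorphisms `R g`. -/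
theorem Model.exists_coact_om_eq [IsAlgClosed 𝔽] (hΓ : IsSymmFrobenius Γ) {n : 𝔽} (hn0 : n ≠ 0)
    (hn : Δ[Γ] ≫ μ[Γ] = n • 𝟙 Γ) (hY : Simple Y) {G : Type*} [Fintype G] (R : G → (Γ ⟶ Γ))
    (hR : ∀ g, R g ≫ Δ[Γ] = Δ[Γ] ≫ (R g ⊗ₘ R g))
    (hsum : ∑ g, R g ▷ Γ ≫ μ[Γ] ≫ ε[Γ] = n • (ε[Γ] ▷ Γ ≫ (λ_ Γ).hom ≫ ε[Γ])) :
    ∃ g, m.coact ≫ om Γ m.M = m.coact ≫ R g ▷ m.M := by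
  have h1 : ∑ g, R g ▷ (Γ ⊗ m.M) ≫ kp Γ m.M = n • (cu Γ (Γ ⊗ m.M) ≫ cu Γ m.M) := by
    have h := congrArg (fun f => (α_ Γ Γ m.M).inv ≫ f ▷ m.M ≫ (λ_ m.M).hom) hsum
    simp only [sum_whiskerRight, Preadditive.sum_comp, Preadditive.comp_sum, comp_whiskerRight,
      Category.assoc, MonoidalLinear.smul_whiskerRight, Linear.smul_comp, Linear.comp_smul] at h
    calc _ = ∑ g, (α_ Γ Γ m.M).inv ≫ R g ▷ Γ ▷ m.M ≫ μ[Γ] ▷ m.M ≫ ε[Γ] ▷ m.M ≫ (λ_ m.M).hom :=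
          Finset.sum_congr rfl fun g _ => by simp [kp, ml, cu]
      _ = _ := by
        rw [h]
        simp [cu]
  -- Summed over `g`, the twisted pairing factors through `ε ⊗ ε`, and both coactions are counital.
  have h2 : ∑ g, monodromyEnd m.coact (R g) = n • 𝟙 m.M := by
    have h3 : ∀ g, monodromyEnd m.coact (R g) =
        m.coact ≫ Γ ◁ (m.coact ≫ om Γ m.M) ≫ R g ▷ (Γ ⊗ m.M) ≫ kp Γ m.M := fun g => by
      rw [monodromyEnd, whisker_exchange_assoc]
    simp only [h3]
    rw [← Preadditive.comp_sum, ← Preadditive.comp_sum, h1, Linear.comp_smul, Linear.comp_smul,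
      reassoc_of% @cu_naturality, (m.isCoaction.comp_om hΓ).counit, Category.comp_id,
      m.isCoaction.counit]
  obtain ⟨g, hg⟩ : ∃ g, monodromyEnd m.coact (R g) ≠ 0 := by
    by_contra! hc
    rw [Finset.sum_eq_zero fun g _ => hc g] at h2
    exact m.id_ne_zero hY ((smul_eq_zero_iff_right hn0).mp h2.symm)
  refine ⟨g, ?_⟩
  obtain ⟨c, hc⟩ := m.exists_eq_smul_id hΓ hn0 hn hY
    (m.isCoaction.isComoduleEnd_monodromyEnd hΓ (R g))
  have hc0 : c ≠ 0 := by
    rintro rfl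
    exact hg (by rw [hc, zero_smul])
  have h := m.isCoaction.monodromyEnd_comp_om hΓ (hR g)
  rw [hc, Linear.smul_comp, Linear.smul_comp, Category.id_comp, Category.id_comp] at h
  exact smul_right_injective _ hc0 h

variable (𝔽) in
include m in
-- The composite `toObj ≫ j` averages to the identity and has trace `d(X, p)`. Symmetry of the trace
-- form gives `tr s = c d(X, p)` when `avg s = c`, and some `s` has non-zero trace.
theorem Model.dim_ne_zero [IsAlgClosed 𝔽] (hΓ : IsSymmFrobenius Γ) {n : 𝔽} (hn0 : n ≠ 0)
    (hn : Δ[Γ] ≫ μ[Γ] = n • 𝟙 Γ) (hθ : (BTC.RibbonCategory.twist Γ).hom = 𝟙 Γ)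
    (hY : Simple Y) : dim 𝔽 Y ≠ 0 := by
  set j : Y.X.obj ⟶ m.M := un Γ _ ≫ m.proj with hj
  have hproj : Γ ◁ j ≫ act m.coact = m.proj := by
    rw [act, hj, ← MonoidalCategory.whiskerLeft_comp_assoc, Category.assoc,
      ← m.cm_whiskerLeft_proj, MonoidalCategory.whiskerLeft_comp,
      MonoidalCategory.whiskerLeft_comp, Category.assoc, Category.assoc, kp_naturality,
      reassoc_of% hΓ.cm_kp_left, reassoc_of% @whiskerLeft_un_ml]
  have havg : avg m.coact (m.toObj ≫ j) = 𝟙 m.M := by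
    rw [avg, MonoidalCategory.whiskerLeft_comp, Category.assoc, hproj,
      reassoc_of% m.coact_whiskerLeft_toObj, m.incl_proj]
  obtain ⟨s, hs⟩ := BTC.exists_trace_ne_zero 𝔽 (m.id_ne_zero hY)
  obtain ⟨c, hc⟩ := m.exists_eq_smul_id hΓ hn0 hn hY (m.isCoaction.isComoduleEnd_avg hΓ s)
  have key := m.isCoaction.trace_avg_comp hΓ hθ (m.toObj ≫ j) s
  rw [havg, Category.id_comp, hc, Linear.smul_comp, Category.id_comp] at key
  intro hd
  have h0 : BTC.trace (m.toObj ≫ j) = 0 := by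
    have h := BTC.unitScalar_smul 𝔽
      (BTC.trace ((λ_ Y.X.obj).inv ≫ η[Γ] ▷ Y.X.obj ≫ idem Y))
    change dim 𝔽 Y • _ = _ at h
    rw [hd, zero_smul] at h
    rw [BTC.trace_comp_comm, h, hj, un]
    simp only [Category.assoc, m.proj_toObj]
  apply hs
  rw [key]
  simp only [BTC.trace, MonoidalLinear.smul_whiskerRight, Linear.smul_comp,
    Linear.comp_smul] at h0 ⊢
  rw [h0, smul_zero]

variable (𝔽) in
-- Tracing out `X` in `p` leaves a morphism `Γ ⟶ 𝟙`, hence a multiple of `ε`. Composing with `η`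
-- identifies the multiple as `d(X, p)`, and the counit law finishes.
theorem partialTrace_idem {Y : Completed Γ} (hone : η[Γ] ≫ ε[Γ] = 𝟙 _)
    (hhom : ∀ f : Γ ⟶ 𝟙_ C, ∃ c : 𝔽, f = c • ε[Γ]) :
    BTC.partialTrace (cm Γ Y.X.obj ≫ Γ ◁ idem Y) = dim 𝔽 Y • 𝟙 Γ := by
  obtain ⟨c, hc⟩ := hhom (BTC.partialTrace (idem Y ≫ (λ_ Y.X.obj).inv))
  have hd : dim 𝔽 Y = c := by
    apply BTC.unitScalar_eq
    have : BTC.trace ((λ_ Y.X.obj).inv ≫ η[Γ] ▷ Y.X.obj ≫ idem Y) =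
        η[Γ] ≫ BTC.partialTrace (idem Y ≫ (λ_ Y.X.obj).inv) := by
      rw [← BTC.partialTrace_whiskerRight_comp, BTC.trace_eq_partialTrace]
      congr 1
      simp
    rw [this, hc, Linear.comp_smul, hone]
  have h := BTC.partialTrace_whiskerLeft Γ (idem Y ≫ (λ_ Y.X.obj).inv)
  rw [hc] at h
  have e : cm Γ Y.X.obj ≫ Γ ◁ idem Y = (Δ[Γ] ▷ Y.X.obj ≫
      ((α_ Γ Γ Y.X.obj).hom ≫ Γ ◁ (idem Y ≫ (λ_ Y.X.obj).inv) ≫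
        (α_ Γ (𝟙_ C) Y.X.obj).inv)) ≫ (ρ_ Γ).hom ▷ Y.X.obj := by
    simp [cm]
  rw [e, BTC.partialTrace_comp_whiskerRight, BTC.partialTrace_whiskerRight_comp, h, hd]
  simp

variable (𝔽) in
/-- The grade of a simple object is one of the automorphisms `R g`. -/
theorem exists_grade_eq [IsAlgClosed 𝔽] (hΓ : IsSymmFrobenius Γ) {n : 𝔽} (hn0 : n ≠ 0)
    (hn : Δ[Γ] ≫ μ[Γ] = n • 𝟙 Γ) (hθ : (BTC.RibbonCategory.twist Γ).hom = 𝟙 Γ)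
    (hone : η[Γ] ≫ ε[Γ] = 𝟙 _) (hhom : ∀ f : Γ ⟶ 𝟙_ C, ∃ c : 𝔽, f = c • ε[Γ])
    {G : Type*} [Fintype G] (R : G → (Γ ⟶ Γ))
    (hR : ∀ g, R g ≫ Δ[Γ] = Δ[Γ] ≫ (R g ⊗ₘ R g))
    (hsum : ∑ g, R g ▷ Γ ≫ μ[Γ] ≫ ε[Γ] = n • (ε[Γ] ▷ Γ ≫ (λ_ Γ).hom ≫ ε[Γ]))
    (hY : Simple Y) : dim 𝔽 Y ≠ 0 ∧ ∃ g, R g = grade 𝔽 Y := by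
  obtain ⟨m⟩ := exists_model Y
  have hd := m.dim_ne_zero 𝔽 hΓ hn0 hn hθ hY
  obtain ⟨g, hg⟩ := m.exists_coact_om_eq hΓ hn0 hn hY R hR hsum
  refine ⟨hd, g, ?_⟩
  -- The identity on `M` passes to `X` by naturality of the monodromy along `toObj`.
  have h : cm Γ Y.X.obj ≫ Γ ◁ idem Y ≫ om Γ Y.X.obj =
      (cm Γ Y.X.obj ≫ Γ ◁ idem Y) ≫ R g ▷ Y.X.obj := by
    rw [← Category.assoc, ← m.proj_incl, ← m.coact_whiskerLeft_toObj, Category.assoc,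
      Category.assoc, Category.assoc, Category.assoc, om_naturality, reassoc_of% hg,
      whisker_exchange]
  have h' : grade 𝔽 Y = (dim 𝔽 Y)⁻¹ • BTC.partialTrace
      (cm Γ Y.X.obj ≫ Γ ◁ idem Y ≫ om Γ Y.X.obj) := by
    simp only [grade, cm, om, Category.assoc]
  rw [h', h, BTC.partialTrace_comp_whiskerRight, partialTrace_idem 𝔽 hone hhom,
    Linear.smul_comp, Category.id_comp, smul_smul, inv_mul_cancel₀ hd, one_smul]

end Linear

end CrossedProduct

/-! ### Transport of Frobenius algebras along braided functors -/

namespace CrossedProduct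

open MonObj ComonObj

section Transport

variable {C : Type*} [Category* C] [MonoidalCategory C] [BraidedCategory C]
  {D : Type*} [Category* D] [MonoidalCategory D] [BraidedCategory D]
  (F : D ⥤ C) [F.Braided] (A : D) [MonObj A] [ComonObj A]

attribute [local instance] Functor.monObjObj Functor.obj.instComonObj

/-- Braided functors preserve symmetric Frobenius algebras. -/
theorem IsSymmFrobenius.map (hA : IsSymmFrobenius A) : IsSymmFrobenius (F.obj A) where
  braiding_braiding := by
    have h := congrArg F.map hA.braiding_braiding
    rw [F.map_comp, F.map_braiding, F.map_id] at h
    rw [← cancel_mono (Functor.LaxMonoidal.μ F A A), ← cancel_epi (Functor.OplaxMonoidal.δ F A A)]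
    simpa using h
  braiding_mul := by
    have h := congrArg F.map hA.braiding_mul
    rw [F.map_comp, F.map_braiding] at h
    rw [← cancel_epi (Functor.OplaxMonoidal.δ F A A)]
    simpa using h
  comul_braiding := by
    have h := congrArg F.map hA.comul_braiding
    rw [F.map_comp, F.map_braiding] at h
    rw [← cancel_mono (Functor.LaxMonoidal.μ F A A)]
    simpa using h
  mul_comul_left := by
    have h := congrArg (fun f => Functor.LaxMonoidal.μ F _ _ ≫ F.map f ≫ Functor.OplaxMonoidal.δ F _ _) hA.mul_comul_left
    simp only [F.map_comp, Category.assoc] at h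
    simp only [Functor.obj.μ_def, Functor.obj.Δ_def, Category.assoc, h]
    simp only [Functor.Monoidal.map_whiskerLeft, Functor.Monoidal.map_whiskerRight,
      Functor.Monoidal.map_associator_inv, Category.assoc,
      Functor.Monoidal.μ_δ, Functor.Monoidal.μ_δ_assoc, Category.comp_id,
      MonoidalCategory.whiskerLeft_comp, comp_whiskerRight]
  mul_comul_right := by
    have h := congrArg (fun f => Functor.LaxMonoidal.μ F _ _ ≫ F.map f ≫ Functor.OplaxMonoidal.δ F _ _) hA.mul_comul_right
    simp only [F.map_comp, Category.assoc] at h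
    simp only [Functor.obj.μ_def, Functor.obj.Δ_def, Category.assoc, h]
    simp only [Functor.Monoidal.map_whiskerLeft, Functor.Monoidal.map_whiskerRight,
      Functor.Monoidal.map_associator, Category.assoc,
      Functor.Monoidal.μ_δ, Functor.Monoidal.μ_δ_assoc, Category.comp_id,
      MonoidalCategory.whiskerLeft_comp, comp_whiskerRight]

end Transport

end CrossedProduct

/-! ### The function algebra of a finite group and its right translations -/

namespace RegularAlgebra

variable (𝔽 : Type w) [Field 𝔽] (G : Type) [Group G] [Fintype G]

/-- Right translation by `g`. -/
def transL {𝔽 : Type w} [Field 𝔽] {G : Type} [Group G] (g : G) : (G → 𝔽) →ₗ[𝔽] (G → 𝔽) :=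
  LinearMap.funLeft 𝔽 𝔽 (fun h => h * g)

/-- Right translation as an endomorphism of the left regular representation. -/
def regTrans (g : G) : regRep 𝔽 G ⟶ regRep 𝔽 G where
  hom := FGModuleCat.ofHom (transL g)
  comm k := by
    apply InducedCategory.hom_ext; apply ModuleCat.hom_ext
    change transL g ∘ₗ regRho 𝔽 G k = regRho 𝔽 G k ∘ₗ transL g
    ext
    simp [regRho, transL, LinearMap.funLeft, _root_.mul_assoc]

theorem braiding_regMul : (β_ (regRep 𝔽 G) (regRep 𝔽 G)).hom ≫ regMul 𝔽 G = regMul 𝔽 G := by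
  apply FDRep_hom_ext
  change mulL 𝔽 G ∘ₗ (TensorProduct.comm 𝔽 _ _).toLinearMap = mulL 𝔽 G
  apply TensorProduct.ext'
  intro x y
  simp [mulL, mul_comm]

theorem regComul_braiding :
    regComul 𝔽 G ≫ (β_ (regRep 𝔽 G) (regRep 𝔽 G)).hom = regComul 𝔽 G := by
  classical
  apply FDRep_hom_ext
  change (TensorProduct.comm 𝔽 _ _).toLinearMap ∘ₗ comulL 𝔽 G = comulL 𝔽 G
  refine LinearMap.pi_ext' fun g => LinearMap.ext_ring ?_
  simp [comulL_single]

theorem regMul_regComul_left : regMul 𝔽 G ≫ regComul 𝔽 G =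
    regRep 𝔽 G ◁ regComul 𝔽 G ≫ (α_ _ _ _).inv ≫ regMul 𝔽 G ▷ regRep 𝔽 G := by
  classical
  apply FDRep_hom_ext
  rw [Action.comp_hom, Action.comp_hom, Action.comp_hom, Action.associator_inv_hom]
  change comulL 𝔽 G ∘ₗ mulL 𝔽 G = TensorProduct.map (mulL 𝔽 G) LinearMap.id ∘ₗ
    (TensorProduct.assoc 𝔽 _ _ _).symm.toLinearMap ∘ₗ
      TensorProduct.map LinearMap.id (comulL 𝔽 G)
  refine TensorProduct.ext (LinearMap.pi_ext' fun g => LinearMap.ext_ring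
    (LinearMap.pi_ext' fun h => LinearMap.ext_ring ?_))
  by_cases hgh : g = h
  · subst hgh
    simp [mulL, comulL_single, ← Pi.single_mul]
  · have h0 : (Pi.single g 1 : G → 𝔽) * Pi.single h 1 = 0 := by
      ext k
      by_cases hk : k = g
      · subst hk; simp [hgh]
      · simp [hk]
    simp [mulL, comulL_single, h0]

theorem regMul_regComul_right : regMul 𝔽 G ≫ regComul 𝔽 G =
    regComul 𝔽 G ▷ regRep 𝔽 G ≫ (α_ _ _ _).hom ≫ regRep 𝔽 G ◁ regMul 𝔽 G := by
  classical
  apply FDRep_hom_ext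
  rw [Action.comp_hom, Action.comp_hom, Action.comp_hom, Action.associator_hom_hom]
  change comulL 𝔽 G ∘ₗ mulL 𝔽 G = TensorProduct.map LinearMap.id (mulL 𝔽 G) ∘ₗ
    (TensorProduct.assoc 𝔽 _ _ _).toLinearMap ∘ₗ
      TensorProduct.map (comulL 𝔽 G) LinearMap.id
  refine TensorProduct.ext (LinearMap.pi_ext' fun g => LinearMap.ext_ring
    (LinearMap.pi_ext' fun h => LinearMap.ext_ring ?_))
  by_cases hgh : g = h
  · subst hgh
    simp [mulL, comulL_single, ← Pi.single_mul, TensorProduct.smul_tmul']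
  · have h0 : (Pi.single g 1 : G → 𝔽) * Pi.single h 1 = 0 := by
      ext k
      by_cases hk : k = g
      · subst hk; simp [hgh]
      · simp [hk]
    simp [mulL, comulL_single, h0, ← TensorProduct.smul_tmul']

theorem isSymmFrobenius_regRep [CharZero 𝔽] :
    CrossedProduct.IsSymmFrobenius (regRep 𝔽 G) where
  braiding_braiding := SymmetricCategory.symmetry _ _
  braiding_mul := braiding_regMul 𝔽 G
  comul_braiding := regComul_braiding 𝔽 G
  mul_comul_left := regMul_regComul_left 𝔽 G
  mul_comul_right := regMul_regComul_right 𝔽 G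

theorem regComul_regMul :
    regComul 𝔽 G ≫ regMul 𝔽 G = (Fintype.card G : 𝔽) • 𝟙 (regRep 𝔽 G) := by
  classical
  apply FDRep_hom_ext
  change mulL 𝔽 G ∘ₗ comulL 𝔽 G = (Fintype.card G : 𝔽) • LinearMap.id
  refine LinearMap.pi_ext' fun g => LinearMap.ext_ring ?_
  simp [mulL, comulL_single, ← Pi.single_mul]

theorem regOne_regCounit [CharZero 𝔽] : regOne 𝔽 G ≫ regCounit 𝔽 G = 𝟙 _ := by
  have hc : (Fintype.card G : 𝔽) ≠ 0 := Nat.cast_ne_zero.mpr Fintype.card_ne_zero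
  apply FDRep_hom_ext
  change counitL 𝔽 G ∘ₗ unitL 𝔽 G = LinearMap.id
  ext
  simp [counitL, unitL, hc]

theorem regOne_regTrans (g : G) : regOne 𝔽 G ≫ regTrans 𝔽 G g = regOne 𝔽 G := by
  apply FDRep_hom_ext
  change transL g ∘ₗ unitL 𝔽 G = unitL 𝔽 G
  ext
  simp [unitL, transL, LinearMap.funLeft]

theorem regMul_regTrans (g : G) :
    regMul 𝔽 G ≫ regTrans 𝔽 G g = (regTrans 𝔽 G g ⊗ₘ regTrans 𝔽 G g) ≫ regMul 𝔽 G := by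
  apply FDRep_hom_ext
  change transL g ∘ₗ mulL 𝔽 G = mulL 𝔽 G ∘ₗ TensorProduct.map (transL g) (transL g)
  apply TensorProduct.ext'
  intro x y
  ext
  simp [mulL, transL, LinearMap.funLeft]

omit [Fintype G] in
theorem transL_single [DecidableEq G] (g h : G) :
    transL g (Pi.single h 1 : G → 𝔽) = Pi.single (h * g⁻¹) 1 := by
  ext k
  simp [transL, LinearMap.funLeft, Pi.single_apply, eq_mul_inv_iff_mul_eq]

theorem regTrans_regComul (g : G) :
    regTrans 𝔽 G g ≫ regComul 𝔽 G = regComul 𝔽 G ≫ (regTrans 𝔽 G g ⊗ₘ regTrans 𝔽 G g) := by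
  classical
  apply FDRep_hom_ext
  change comulL 𝔽 G ∘ₗ transL g = TensorProduct.map (transL g) (transL g) ∘ₗ comulL 𝔽 G
  refine LinearMap.pi_ext' fun h => LinearMap.ext_ring ?_
  simp [transL_single, comulL_single]

theorem regTrans_comp_inv (g : G) : regTrans 𝔽 G g ≫ regTrans 𝔽 G g⁻¹ = 𝟙 _ := by
  apply FDRep_hom_ext
  change transL g⁻¹ ∘ₗ transL g = LinearMap.id
  ext
  simp [transL, LinearMap.funLeft]

/-- The linear map underlying a morphism of representations, as an additive map. -/
def toLinear {𝔽 : Type w} [Field 𝔽] {G : Type} [Group G] (V W : FDRep 𝔽 G) :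
    (V ⟶ W) →+ (V →ₗ[𝔽] W) where
  toFun f := f.hom.hom.hom
  map_zero' := rfl
  map_add' _ _ := rfl

/-- On functions this reads `∑ g k, x (k g) y k = (∑ x) (∑ y)`; the normalization of `ε` leaves the
factor `|G|`. -/
theorem sum_regTrans [CharZero 𝔽] :
    ∑ g, regTrans 𝔽 G g ▷ regRep 𝔽 G ≫ regMul 𝔽 G ≫ regCounit 𝔽 G =
      (Fintype.card G : 𝔽) •
        (regCounit 𝔽 G ▷ regRep 𝔽 G ≫ (λ_ (regRep 𝔽 G)).hom ≫ regCounit 𝔽 G) := by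
  have hc : (Fintype.card G : 𝔽) ≠ 0 := Nat.cast_ne_zero.mpr Fintype.card_ne_zero
  have hr : (regCounit 𝔽 G ▷ regRep 𝔽 G ≫ (λ_ (regRep 𝔽 G)).hom ≫
      regCounit 𝔽 G).hom.hom.hom = counitL 𝔽 G ∘ₗ
        (TensorProduct.lid 𝔽 (G → 𝔽)).toLinearMap ∘ₗ
          TensorProduct.map (counitL 𝔽 G) LinearMap.id := by
    rw [Action.comp_hom, Action.comp_hom, Action.leftUnitor_hom_hom]
    rfl
  apply FDRep_hom_ext
  refine (map_sum (toLinear _ _) _ _).trans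
    (Eq.trans ?_ (congrArg ((Fintype.card G : 𝔽) • ·) hr).symm)
  change ∑ g, counitL 𝔽 G ∘ₗ mulL 𝔽 G ∘ₗ TensorProduct.map (transL g) LinearMap.id =
    (Fintype.card G : 𝔽) • (counitL 𝔽 G ∘ₗ (TensorProduct.lid 𝔽 (G → 𝔽)).toLinearMap ∘ₗ
      TensorProduct.map (counitL 𝔽 G) LinearMap.id)
  apply TensorProduct.ext'
  intro x y
  have h : ∀ k, ∑ g, x (k * g) = ∑ g, x g := fun k => Equiv.sum_comp (Equiv.mulLeft k) x
  simp only [counitL, mulL, transL, LinearMap.funLeft, LinearMap.sum_apply,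
    LinearMap.comp_apply, TensorProduct.map_tmul, LinearMap.smul_apply, LinearMap.proj_apply,
    LinearMap.mul'_apply, LinearEquiv.coe_coe, TensorProduct.lid_tmul, LinearMap.id_apply,
    Pi.mul_apply, Pi.smul_apply, LinearMap.coe_mk, AddHom.coe_mk, Function.comp_apply,
    smul_eq_mul, ← Finset.mul_sum]
  rw [Finset.sum_comm]
  simp only [← Finset.sum_mul, h]
  rw [← Finset.mul_sum]
  field_simp

theorem exists_eq_smul_regCounit [CharZero 𝔽] (f : regRep 𝔽 G ⟶ 𝟙_ (FDRep 𝔽 G)) :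
    ∃ c : 𝔽, f = c • regCounit 𝔽 G := by
  classical
  have hc : (Fintype.card G : 𝔽) ≠ 0 := Nat.cast_ne_zero.mpr Fintype.card_ne_zero
  let L : (G → 𝔽) →ₗ[𝔽] 𝔽 := f.hom.hom.hom
  have hL : ∀ g, L ∘ₗ regRho 𝔽 G g = L := fun g =>
    congrArg (fun φ => ModuleCat.Hom.hom (InducedCategory.Hom.hom φ)) (f.comm g)
  -- Equivariance makes `L` constant on the `δ_g`, where `ε` takes the value `|G|⁻¹`.
  refine ⟨Fintype.card G * L (Pi.single 1 1), ?_⟩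
  apply FDRep_hom_ext
  change L = (Fintype.card G * L (Pi.single 1 1)) • counitL 𝔽 G
  refine LinearMap.pi_ext' fun g => LinearMap.ext_ring ?_
  have h1 : regRho 𝔽 G g (Pi.single 1 1) = Pi.single g 1 := by
    ext k
    simp [regRho, LinearMap.funLeft, Pi.single_apply, inv_mul_eq_iff_eq_mul]
  have h2 := LinearMap.congr_fun (hL g) (Pi.single 1 1)
  rw [LinearMap.comp_apply, h1] at h2
  simp only [LinearMap.comp_apply, LinearMap.single_apply, LinearMap.smul_apply, counitL_single,
    h2, smul_eq_mul]
  field_simp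

/-- The Frobenius trace of an endomorphism of the regular representation. -/
theorem regTrace [CharZero 𝔽] (f : regRep 𝔽 G ⟶ regRep 𝔽 G) :
    regOne 𝔽 G ≫ regComul 𝔽 G ≫ f ▷ regRep 𝔽 G ≫ regMul 𝔽 G ≫ regCounit 𝔽 G =
      LinearMap.trace 𝔽 (G → 𝔽) f.hom.hom.hom • 𝟙 _ := by
  classical
  have hc : (Fintype.card G : 𝔽) ≠ 0 := Nat.cast_ne_zero.mpr Fintype.card_ne_zero
  let L : (G → 𝔽) →ₗ[𝔽] (G → 𝔽) := f.hom.hom.hom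
  apply FDRep_hom_ext
  change counitL 𝔽 G ∘ₗ mulL 𝔽 G ∘ₗ TensorProduct.map L LinearMap.id ∘ₗ comulL 𝔽 G ∘ₗ
    unitL 𝔽 G = LinearMap.trace 𝔽 (G → 𝔽) L • LinearMap.id
  refine LinearMap.ext_ring ?_
  rw [LinearMap.trace_eq_matrix_trace 𝔽 (Pi.basisFun 𝔽 G), Matrix.trace]
  simp [unitL, comulL, counitL, mulL, Finset.sum_apply, Finset.mul_sum, Pi.single_apply, hc]

end RegularAlgebra

/-! ### The twist and the automorphisms of the Galois algebra -/

namespace CrossedProduct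

open MonObj ComonObj

section Twist

open BTC.RibbonCategory

section

variable {C : Type u} [Category.{v} C] [MonoidalCategory C] [BraidedCategory C]
  [RigidCategory C] [BTC.RibbonCategory C]

/-- Any pairing comes from a morphism `Γ ⟶ Γᘁ`. The twist is natural along it, and the twist of the
dual is the mate of the twist. -/
theorem twist_pairing_comm {Γ : C} (e : Γ ⊗ Γ ⟶ 𝟙_ C) :
    (twist Γ).hom ▷ Γ ≫ e = Γ ◁ (twist Γ).hom ≫ e := by
  obtain ⟨φ, rfl⟩ : ∃ φ : Γ ⟶ Γᘁ, e = φ ▷ Γ ≫ ε_ Γ Γᘁ := by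
    refine ⟨tensorRightHomEquiv Γ Γ Γᘁ (𝟙_ C) e ≫ (λ_ _).hom, ?_⟩
    have h := (tensorRightHomEquiv Γ Γ Γᘁ (𝟙_ C)).symm_apply_apply e
    generalize tensorRightHomEquiv Γ Γ Γᘁ (𝟙_ C) e = g at h ⊢
    rw [← h]
    change g ▷ Γ ≫ _ = _
    monoidal
  rw [← comp_whiskerRight_assoc, ← twist_naturality, twist_dual, comp_whiskerRight,
    Category.assoc, rightAdjointMate_comp_evaluation, whisker_exchange_assoc]

end


variable {C : Type u} [Category.{v} C] [MonoidalCategory C] [BraidedCategory C]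
  {Γ : C} [MonObj Γ] [ComonObj Γ] (hΓ : IsSymmFrobenius Γ)

include hΓ

/-- The Frobenius pairing is non-degenerate. -/
theorem IsSymmFrobenius.eq_of_pairing_eq {X : C} {a b : X ⟶ Γ}
    (h : a ▷ Γ ≫ μ[Γ] ≫ ε[Γ] = b ▷ Γ ≫ μ[Γ] ≫ ε[Γ]) : a = b := by
  let _ := hΓ.exactPairing
  let _ : HasRightDual Γ := ⟨Γ⟩
  have ha := tensorRightHomEquiv_whiskerRight_comp_evaluation (X := Γ) a
  have hb := tensorRightHomEquiv_whiskerRight_comp_evaluation (X := Γ) b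
  rw [← cancel_mono (λ_ Γ).inv]
  exact ha.symm.trans ((congrArg _ h).trans hb)

variable [RigidCategory C] [BTC.RibbonCategory C]

/-- Trivial self-monodromy makes the twist multiplicative, so it preserves the Frobenius pairing; it
is also self-adjoint for that pairing, and non-degeneracy gives the involution. -/
theorem IsSymmFrobenius.twist_twist : (twist Γ).hom ≫ (twist Γ).hom = 𝟙 Γ := by
  apply hΓ.eq_of_pairing_eq
  have h1 : μ[Γ] ≫ (twist Γ).hom = ((twist Γ).hom ⊗ₘ (twist Γ).hom) ≫ μ[Γ] := by
    rw [twist_naturality, twist_tensor, reassoc_of% hΓ.braiding_braiding]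
  have h2 : (twist Γ).hom ≫ ε[Γ] = ε[Γ] := by
    rw [← twist_naturality, BTC.twist_unit, Category.comp_id]
  rw [comp_whiskerRight, Category.assoc, twist_pairing_comm, id_whiskerRight, Category.id_comp,
    ← MonoidalCategory.tensorHom_def'_assoc, ← reassoc_of% h1, h2]

theorem IsSymmFrobenius.trace_eq (f : Γ ⟶ Γ) :
    BTC.trace f = η[Γ] ≫ Δ[Γ] ≫ (f ≫ (twist Γ).hom) ▷ Γ ≫ μ[Γ] ≫ ε[Γ] := by
  let _ := hΓ.exactPairing
  rw [BTC.trace_eq_braidedTrace Γ, BTC.braidedTrace]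
  change (η[Γ] ≫ Δ[Γ]) ≫ _ ≫ _ ≫ μ[Γ] ≫ ε[Γ] = _
  rw [reassoc_of% hΓ.braiding_mul, Category.assoc]

end Twist

section Galois

variable {𝔽 : Type w} [Field 𝔽] {G : Type} [Group G] [Fintype G]
  {C : Type u} [Category.{v} C] (F : FDRep 𝔽 G ⥤ C)

/-- The automorphism of the Galois algebra induced by a right translation. -/
def galoisTrans (g : G) : galoisAlgebra F ⟶ galoisAlgebra F :=
  F.map (RegularAlgebra.regTrans 𝔽 G g)

theorem galoisTrans_comp_inv (g : G) : galoisTrans F g ≫ galoisTrans F g⁻¹ = 𝟙 _ := by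
  have h := congrArg F.map (RegularAlgebra.regTrans_comp_inv 𝔽 G g)
  rw [F.map_comp, F.map_id] at h
  exact h

variable [MonoidalCategory C] [BraidedCategory C] [F.Braided]

instance (g : G) : IsMonHom (galoisTrans F g) where
  one_hom := by
    have h := congrArg F.map (RegularAlgebra.regOne_regTrans 𝔽 G g)
    rw [F.map_comp] at h
    change (Functor.LaxMonoidal.ε F ≫ F.map (RegularAlgebra.regOne 𝔽 G)) ≫ F.map _ =
      Functor.LaxMonoidal.ε F ≫ F.map (RegularAlgebra.regOne 𝔽 G)
    rw [Category.assoc, h]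
  mul_hom := by
    have h := congrArg F.map (RegularAlgebra.regMul_regTrans 𝔽 G g)
    rw [F.map_comp, F.map_comp] at h
    change (Functor.LaxMonoidal.μ F _ _ ≫ F.map (RegularAlgebra.regMul 𝔽 G)) ≫ F.map _ =
      (F.map _ ⊗ₘ F.map _) ≫ Functor.LaxMonoidal.μ F _ _ ≫ F.map (RegularAlgebra.regMul 𝔽 G)
    rw [Category.assoc, h, Functor.LaxMonoidal.μ_natural_assoc]

/-- The element of the automorphism group of the Galois algebra given by a right translation. -/
def galoisAut (g : G) : Aut (Mon.mk (galoisAlgebra F)) where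
  hom := Mon.Hom.mk (galoisTrans F g)
  inv := Mon.Hom.mk (galoisTrans F g⁻¹)
  hom_inv_id := by
    apply Mon.Hom.ext
    exact galoisTrans_comp_inv F g
  inv_hom_id := by
    apply Mon.Hom.ext
    simpa using galoisTrans_comp_inv F g⁻¹

variable [CharZero 𝔽]

theorem isSymmFrobenius_galoisAlgebra : IsSymmFrobenius (galoisAlgebra F) :=
  (RegularAlgebra.isSymmFrobenius_regRep 𝔽 G).map F

theorem galoisTrans_comul (g : G) :
    galoisTrans F g ≫ Δ[galoisAlgebra F] =
      Δ[galoisAlgebra F] ≫ (galoisTrans F g ⊗ₘ galoisTrans F g) := by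
  have h := congrArg F.map (RegularAlgebra.regTrans_regComul 𝔽 G g)
  rw [F.map_comp, F.map_comp] at h
  change F.map _ ≫ F.map (RegularAlgebra.regComul 𝔽 G) ≫ Functor.OplaxMonoidal.δ F _ _ =
    (F.map (RegularAlgebra.regComul 𝔽 G) ≫ Functor.OplaxMonoidal.δ F _ _) ≫
      (F.map _ ⊗ₘ F.map _)
  rw [Category.assoc, Functor.OplaxMonoidal.δ_natural, reassoc_of% h]

theorem galois_one_counit : η[galoisAlgebra F] ≫ ε[galoisAlgebra F] = 𝟙 _ := by
  have h := congrArg F.map (RegularAlgebra.regOne_regCounit 𝔽 G)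
  rw [F.map_comp, F.map_id] at h
  change (Functor.LaxMonoidal.ε F ≫ F.map (RegularAlgebra.regOne 𝔽 G)) ≫
    F.map (RegularAlgebra.regCounit 𝔽 G) ≫ Functor.OplaxMonoidal.η F = 𝟙 _
  rw [Category.assoc, reassoc_of% h, Functor.Monoidal.ε_η]

variable [Preadditive C] [Linear 𝔽 C] [F.Linear 𝔽]

theorem galois_comul_mul :
    Δ[galoisAlgebra F] ≫ μ[galoisAlgebra F] = (Fintype.card G : 𝔽) • 𝟙 (galoisAlgebra F) := by
  have h := congrArg F.map (RegularAlgebra.regComul_regMul 𝔽 G)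
  rw [F.map_comp, F.map_smul, F.map_id] at h
  change (F.map (RegularAlgebra.regComul 𝔽 G) ≫ Functor.OplaxMonoidal.δ F _ _) ≫
    Functor.LaxMonoidal.μ F _ _ ≫ F.map (RegularAlgebra.regMul 𝔽 G) = _
  rw [Category.assoc, Functor.Monoidal.δ_μ_assoc, h]
  rfl

theorem galois_exists_eq_smul_counit [F.Full] (f : galoisAlgebra F ⟶ 𝟙_ C) :
    ∃ c : 𝔽, f = c • ε[galoisAlgebra F] := by
  change F.obj (RegularAlgebra.regRep 𝔽 G) ⟶ 𝟙_ C at f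
  obtain ⟨f', hf'⟩ := F.map_surjective (X := RegularAlgebra.regRep 𝔽 G)
    (f ≫ Functor.LaxMonoidal.ε F)
  obtain ⟨c, hc⟩ := RegularAlgebra.exists_eq_smul_regCounit 𝔽 G f'
  refine ⟨c, ?_⟩
  change f = c • (F.map (RegularAlgebra.regCounit 𝔽 G) ≫ Functor.OplaxMonoidal.η F)
  rw [← Linear.smul_comp, ← F.map_smul, ← hc, hf', Category.assoc, Functor.Monoidal.ε_η,
    Category.comp_id]

theorem galois_trace (f : RegularAlgebra.regRep 𝔽 G ⟶ RegularAlgebra.regRep 𝔽 G) :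
    η[galoisAlgebra F] ≫ Δ[galoisAlgebra F] ≫ F.map f ▷ galoisAlgebra F ≫
        μ[galoisAlgebra F] ≫ ε[galoisAlgebra F] =
      LinearMap.trace 𝔽 (G → 𝔽) f.hom.hom.hom • 𝟙 _ := by
  have h := congrArg (fun f => Functor.LaxMonoidal.ε F ≫ F.map f ≫
    Functor.OplaxMonoidal.η F) (RegularAlgebra.regTrace 𝔽 G f)
  simp only [F.map_comp, F.map_smul, Linear.comp_smul, Linear.smul_comp, Category.assoc,
    F.map_id, Category.id_comp, Functor.Monoidal.ε_η, Functor.Monoidal.map_whiskerRight] at h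
  refine Eq.trans ?_ h
  change (Functor.LaxMonoidal.ε F ≫ F.map (RegularAlgebra.regOne 𝔽 G)) ≫
    (F.map (RegularAlgebra.regComul 𝔽 G) ≫ Functor.OplaxMonoidal.δ F _ _) ≫ F.map f ▷ _ ≫
    (Functor.LaxMonoidal.μ F _ _ ≫ F.map (RegularAlgebra.regMul 𝔽 G)) ≫
    F.map (RegularAlgebra.regCounit 𝔽 G) ≫ Functor.OplaxMonoidal.η F = _
  simp only [Category.assoc]

variable [F.Additive]

theorem sum_galoisTrans :
    ∑ g, galoisTrans F g ▷ galoisAlgebra F ≫ μ[galoisAlgebra F] ≫ ε[galoisAlgebra F] =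
      (Fintype.card G : 𝔽) • (ε[galoisAlgebra F] ▷ galoisAlgebra F ≫
        (λ_ (galoisAlgebra F)).hom ≫ ε[galoisAlgebra F]) := by
  have h := congrArg (fun f => Functor.LaxMonoidal.μ F _ _ ≫ F.map f ≫
    Functor.OplaxMonoidal.η F) (RegularAlgebra.sum_regTrans 𝔽 G)
  simp only [F.map_sum, F.map_comp, F.map_smul, Preadditive.comp_sum, Preadditive.sum_comp,
    Linear.comp_smul, Linear.smul_comp, Category.assoc,
    ← Functor.LaxMonoidal.μ_natural_left_assoc] at h
  refine Eq.trans ?_ (h.trans ?_)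
  · refine Finset.sum_congr rfl fun g _ => ?_
    change F.map _ ▷ _ ≫ (Functor.LaxMonoidal.μ F _ _ ≫ F.map (RegularAlgebra.regMul 𝔽 G)) ≫
      F.map (RegularAlgebra.regCounit 𝔽 G) ≫ Functor.OplaxMonoidal.η F = _
    simp only [Category.assoc]
  · congr 1
    rw [Functor.Monoidal.map_leftUnitor]
    change _ = (F.map (RegularAlgebra.regCounit 𝔽 G) ≫ Functor.OplaxMonoidal.η F) ▷
      F.obj (RegularAlgebra.regRep 𝔽 G) ≫ (λ_ (F.obj (RegularAlgebra.regRep 𝔽 G))).hom ≫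
        F.map (RegularAlgebra.regCounit 𝔽 G) ≫ Functor.OplaxMonoidal.η F
    simp only [Category.assoc, comp_whiskerRight, Functor.Monoidal.μ_δ_assoc]

end Galois

end CrossedProduct

/-! ### Admissibility forces a trivial twist -/

namespace CrossedProduct

open MonObj ComonObj BTC.RibbonCategory

section Admissible

variable {𝔽 : Type w} [Field 𝔽] [CharZero 𝔽] {C : Type u} [Category.{v} C] [Abelian C]
  [Linear 𝔽 C] [MonoidalCategory C] [MonoidalPreadditive C] [MonoidalLinear 𝔽 C]
  [BraidedCategory C] [RigidCategory C] [BTC.RibbonCategory C] [BTC.IsBTC 𝔽 C]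

/-- If every retract of the Galois algebra has a natural number as its dimension, then the Galois
algebra has trivial twist. -/
theorem twist_galoisAlgebra_of_dim {G : Type} [Group G] [Fintype G] (F : FDRep 𝔽 G ⥤ C)
    [F.Braided] [F.Additive] [F.Linear 𝔽] [F.Full] [F.Faithful]
    (hdim : ∀ X : C, Retract X (galoisAlgebra F) → ∃ n : ℕ, BTC.dim 𝔽 X = n) :
    (twist (galoisAlgebra F)).hom = 𝟙 _ := by
  have hΓ := isSymmFrobenius_galoisAlgebra F
  obtain ⟨θ, hθ⟩ := F.map_surjective (X := RegularAlgebra.regRep 𝔽 G)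
    (Y := RegularAlgebra.regRep 𝔽 G) (twist (galoisAlgebra F)).hom
  have hθθ : θ ≫ θ = 𝟙 _ := by
    apply F.map_injective
    rw [F.map_comp, hθ, F.map_id]
    exact hΓ.twist_twist
  -- The projector onto the `-1` part of the involution `θ`.
  set e := (2⁻¹ : 𝔽) • (𝟙 _ - θ) with he
  have heθ : e ≫ θ = -e := by
    rw [he, Linear.smul_comp, Preadditive.sub_comp, hθθ, Category.id_comp, ← smul_neg, neg_sub]
  have hee : e ≫ e = e := by
    nth_rewrite 2 [he]
    rw [Linear.comp_smul, Preadditive.comp_sub, heθ, Category.comp_id, sub_neg_eq_add,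
      ← two_smul 𝔽, smul_smul, inv_mul_cancel₀ two_ne_zero, one_smul]
  obtain ⟨a, ha⟩ : ∃ a : galoisAlgebra F ⟶ galoisAlgebra F, a = F.map e := ⟨_, rfl⟩
  have haa : a ≫ a = a := by
    rw [ha]
    exact (F.map_comp e e).symm.trans (congrArg F.map hee)
  have haθ : a ≫ (twist (galoisAlgebra F)).hom = -a := by
    rw [ha, ← hθ]
    exact (F.map_comp e θ).symm.trans ((congrArg F.map heθ).trans F.map_neg)
  have hatr : η[galoisAlgebra F] ≫ Δ[galoisAlgebra F] ≫ a ▷ galoisAlgebra F ≫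
      μ[galoisAlgebra F] ≫ ε[galoisAlgebra F] =
        LinearMap.trace 𝔽 (G → 𝔽) e.hom.hom.hom • 𝟙 _ := by
    rw [ha]
    exact galois_trace F e
  obtain ⟨X, i, r, hir, hri⟩ := IsIdempotentComplete.idempotents_split _ a haa
  obtain ⟨n, hn⟩ := hdim X ⟨i, r, hir⟩
  -- The categorical trace is the linear trace corrected by the twist, which is `-1` on the image of
  -- `a`.
  have htr : BTC.trace (𝟙 X) = (-LinearMap.trace 𝔽 (G → 𝔽) e.hom.hom.hom) • 𝟙 _ := by
    have hneg : (-a) ▷ galoisAlgebra F = -(a ▷ galoisAlgebra F) :=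
      (tensorRight (galoisAlgebra F)).map_neg
    rw [← hir, BTC.trace_comp_comm, hri, hΓ.trace_eq, haθ, neg_smul, ← hatr, hneg]
    simp only [Preadditive.neg_comp, Preadditive.comp_neg]
  have hdimX : (n : 𝔽) = -LinearMap.trace 𝔽 (G → 𝔽) e.hom.hom.hom :=
    hn.symm.trans (BTC.unitScalar_eq 𝔽 htr)
  let L : (G → 𝔽) →ₗ[𝔽] (G → 𝔽) := e.hom.hom.hom
  have hL : IsIdempotentElem L :=
    congrArg (fun φ : RegularAlgebra.regRep 𝔽 G ⟶ RegularAlgebra.regRep 𝔽 G =>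
      φ.hom.hom.hom) hee
  have hL0 : L = 0 := by
    apply LinearMap.IsIdempotentElem.eq_zero_of_trace_eq_zero hL
    -- The trace of an idempotent is its rank, so a natural number equals minus a rank and both
    -- vanish in characteristic zero.
    have hrank := (LinearMap.IsIdempotentElem.isProj_range L hL).trace
    change (n : 𝔽) = -LinearMap.trace 𝔽 (G → 𝔽) L at hdimX
    rw [hrank] at hdimX ⊢
    have h0 : ((n + Module.finrank 𝔽 (LinearMap.range L) : ℕ) : 𝔽) = 0 := by
      push_cast
      rw [hdimX]
      ring
    rw [Nat.cast_eq_zero] at h0 ⊢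
    omega
  have he0 : e = 0 := RegularAlgebra.FDRep_hom_ext hL0
  rw [he, smul_eq_zero_iff_right (inv_ne_zero two_ne_zero), sub_eq_zero] at he0
  rw [← hθ, ← he0, F.map_id]
  rfl

/-- The Galois algebra of an admissible subcategory has trivial twist. -/
theorem twist_galoisAlgebra (S : ObjectProperty C) [BTC.IsFiniteSubSTC S]
    (hadm : BTC.IsAdmissible 𝔽 S) {G : Type} [Group G] [Fintype G]
    (E : FDRep 𝔽 G ≌ S.FullSubcategory) [E.functor.Braided] [E.functor.Additive]
    [E.functor.Linear 𝔽] :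
    (twist (galoisAlgebra (E.functor ⋙ S.ι))).hom = 𝟙 _ := by
  have hS : S (galoisAlgebra (E.functor ⋙ S.ι)) := (E.functor.obj _).property
  rcases hadm with ⟨-, -, h⟩ | ⟨-, h⟩
  · exact h _ hS
  · refine twist_galoisAlgebra_of_dim (E.functor ⋙ S.ι) fun X hX => ?_
    obtain ⟨X', hX', ⟨e⟩⟩ := BTC.IsFiniteSubSTC.retract _ X hS hX
    obtain ⟨n, hn⟩ := h X' hX'
    refine ⟨n, ?_⟩
    rw [← hn, BTC.dim, BTC.dim, ← e.hom_inv_id, BTC.trace_comp_comm, e.inv_hom_id]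

end Admissible

end CrossedProduct

end

theorem mainTheorem5
    {𝔽 : Type w} [Field 𝔽] [IsAlgClosed 𝔽] [CharZero 𝔽]
    {C : Type u} [Category.{v} C] [Abelian C] [Linear 𝔽 C]
    [MonoidalCategory C] [MonoidalPreadditive C] [MonoidalLinear 𝔽 C] [BraidedCategory C]
    [RigidCategory C] [BTC.RibbonCategory C] [BTC.IsBTC 𝔽 C]
    (S : ObjectProperty C) [BTC.IsFiniteSubSTC S]
    (hadm : BTC.IsAdmissible 𝔽 S)
    (G : Type) [Group G] [Fintype G]
    (E : FDRep 𝔽 G ≌ S.FullSubcategory)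
    [E.functor.Braided] [E.functor.Additive] [E.functor.Linear 𝔽]
    (Y : CrossedProduct.Completed (CrossedProduct.galoisAlgebra (E.functor ⋙ S.ι)))
    (hY : Simple Y) :
    CrossedProduct.dim 𝔽 Y ≠ 0 ∧
      ∃ g : Aut (Mon.mk (CrossedProduct.galoisAlgebra (E.functor ⋙ S.ι))),
        g.hom.hom = CrossedProduct.grade 𝔽 Y := by
  obtain ⟨hd, g, hg⟩ := CrossedProduct.exists_grade_eq 𝔽
    (CrossedProduct.isSymmFrobenius_galoisAlgebra (E.functor ⋙ S.ι))
    (Nat.cast_ne_zero.mpr Fintype.card_ne_zero)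
    (CrossedProduct.galois_comul_mul (E.functor ⋙ S.ι))
    (CrossedProduct.twist_galoisAlgebra S hadm E)
    (CrossedProduct.galois_one_counit (E.functor ⋙ S.ι))
    (CrossedProduct.galois_exists_eq_smul_counit (E.functor ⋙ S.ι))
    (CrossedProduct.galoisTrans (E.functor ⋙ S.ι))
    (CrossedProduct.galoisTrans_comul (E.functor ⋙ S.ι))
    (CrossedProduct.sum_galoisTrans (E.functor ⋙ S.ι)) hY
  exact ⟨hd, CrossedProduct.galoisAut (E.functor ⋙ S.ι) g, hg⟩
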